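/- For a ring $A$, let $\mathsf{K}(\mathrm{Proj}\,A)$ be the homotopy category of (unbounded) cochain complexes of projective left $A$-modules, and let $\mathsf{E}(A)$ be its full subcategory of complete projective resolutions, that is, of exact complexes $E$ of projective $A$-modules such that $\operatorname{Hom}_A(E,Q)$ is exact for each projective $A$-module $Q$. Let $e_*:\mathsf{E}(A)\to\mathsf{K}(\mathrm{Proj}\,A)$ be the inclusion, and let $\operatorname{res}:\mathsf{Mod}(A)\to\mathsf{K}(\mathrm{Proj}\,A)$ be the functor which sends a module to a projective resolution of it, concentrated in non-positive cohomological degrees. If $e_*$ has a right adjoint $e^!$, the Tate Ext groups over $A$ are defined by $$\widehat{\operatorname{Ext}}{}^i_A(M,N)=\operatorname{H}^i\operatorname{Hom}_A(e^!\operatorname{res}M,N)\qquad(i\in\mathbb{Z}).$$ **Proposition.** Let $k$ be a field, $G$ a finite group, and $N$ a finite-dimensional $k$-linear representation of $G$. Then the Tate Ext groups over the group algebra $kG$ are defined, that is, the inclusion $e_*:\mathsf{E}(kG)\to\mathsf{K}(\mathrm{Proj}\,kG)$ has a right adjoint $e^!$. For any such right adjoint and each $i\in\mathbb{Z}$ there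 is an isomorphism of $k$-vector spaces $$\widehat{\operatorname{Ext}}{}^i_{kG}(k,N)\cong\widehat{H}^i(G,N),$$ where $k$ is the trivial representation and $\widehat{H}^i(G,N)$ is the $i$-th classical Tate cohomology group of $G$ with coefficients in $N$. -/

import Mathlib

open CategoryTheory

universe u

noncomputable section

namespace TateExt

/-- The complex `Hom_A(X, N)` of `k`-modules, for a complex `X` of `A`-modules and an `A`-module `N`.
It is indexed by the degrees of `X`: the term at the index `j` is `Hom_A(X^j, N)`, which sits in
cohomological degree `-j`. Here `k` is any ring over which `A`-modules form a linear category,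
for instance `ℤ` for every ring `A`, and `k` itself for an algebra `A` over a field `k`. -/
def homComplex (k : Type*) [Ring k] {A : Type u} [Ring A] [Linear k (ModuleCat.{u} A)]
    (X : CochainComplex (ModuleCat.{u} A) ℤ) (N : ModuleCat.{u} A) :
    HomologicalComplex (ModuleCat k) (ComplexShape.up ℤ).symm :=
  (((linearYoneda k (ModuleCat.{u} A)).obj N).mapHomologicalComplex _).obj X.op

/-- The cohomology `H^i Hom_A(X, N)`. -/
def homCohomology (k : Type*) [Ring k] {A : Type u} [Ring A] [Linear k (ModuleCat.{u} A)]
    (X : CochainComplex (ModuleCat.{u} A) ℤ) (N : ModuleCat.{u} A) (i : ℤ) : ModuleCat k :=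
  (homComplex k X N).homology (-i)

/-- The complexes of projective `A`-modules, as objects of the homotopy category `K(A)`. -/
def isComplexOfProjectives (A : Type u) [Ring A] :
    ObjectProperty (HomotopyCategory (ModuleCat.{u} A) (ComplexShape.up ℤ)) :=
  fun X => ∀ i : ℤ, Projective (X.as.X i)

/-- `K(Proj A)`, the homotopy category of complexes of projective `A`-modules. -/
abbrev KProj (A : Type u) [Ring A] := (isComplexOfProjectives A).FullSubcategory

/-- The complex of `A`-modules underlying an object of `K(Proj A)`. -/
abbrev KProj.complex {A : Type u} [Ring A] (X : KProj A) : CochainComplex (ModuleCat.{u} A) ℤ :=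
  X.obj.as

/-- Complete projective resolutions: exact complexes `X` of projective `A`-modules such that
`Hom_A(X, Q)` is exact for each projective `A`-module `Q`. -/
def isCompleteResolution (A : Type u) [Ring A] : ObjectProperty (KProj A) :=
  fun X => X.complex.Acyclic ∧
    ∀ Q : ModuleCat.{u} A, Projective Q → (homComplex ℤ X.complex Q).Acyclic

/-- `E(A)`, the full subcategory of `K(Proj A)` of complete projective resolutions. -/
abbrev E (A : Type u) [Ring A] := (isCompleteResolution A).FullSubcategory

/-- The inclusion functor `e_* : E(A) ⥤ K(Proj A)`. -/
abbrev inclusion (A : Type u) [Ring A] : E A ⥤ KProj A := (isCompleteResolution A).ι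

/-- The functor `res : Mod(A) ⥤ K(Proj A)` which sends a module to a projective resolution of it,
viewed as a cochain complex concentrated in non-positive degrees, and a homomorphism to the
homotopy class of its lifts. -/
def res (A : Type u) [Ring A] : ModuleCat.{u} A ⥤ KProj A :=
  (isComplexOfProjectives A).lift
    (projectiveResolutions (ModuleCat.{u} A) ⋙
      ComplexShape.embeddingDownNat.extendHomotopyFunctor (ModuleCat.{u} A))
    (fun M i => inferInstanceAs (Projective ((projectiveResolution M).cochainComplex.X i)))

/-- The Tate Ext group `H^i Hom_A(e^! res M, N)`, formed with a right adjoint `e^!` (the functor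
`eShriek`) of the inclusion `e_*`. -/
def tateExt (k : Type*) [Ring k] {A : Type u} [Ring A] [Linear k (ModuleCat.{u} A)]
    {eShriek : KProj A ⥤ E A} (_adj : inclusion A ⊣ eShriek)
    (M N : ModuleCat.{u} A) (i : ℤ) : ModuleCat k :=
  homCohomology k (eShriek.obj ((res A).obj M)).obj.complex N i

end TateExt

end

/-!
Let `A = k[G]`. The averaging argument behind Higman's criterion (`HasUnitTrace`) shows that
projective and injective `A`-modules coincide. Hence `Hom_A(E, Q)` is exact for every exact complex
`E` and every projective `Q`, so that a complete projective resolution is nothing but an acyclic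
complex of projective modules. A right adjoint of the inclusion into `K(Proj A)` therefore exists as
soon as each complex `X` of projective modules receives a couniversal map, up to homotopy, from an
acyclic complex of projective modules (`IsAcyclicCoreflection`).

Such a map is built as follows. Every complex over the field `k` is K-injective, hence so is the
coinduced complex `Hom_k(A, X)`, and its terms are injective. Maps from acyclic complexes to `X`
lift to the cocone of the embedding `X ⟶ Hom_k(A, X)`, together with their null-homotopies, and the
projection from this cocone to `X` sends cocycles to coboundaries, because the embedding is split
over `k`. If the construction is iterated, the inverse limit of the resulting tower is acyclic by a
Mittag-Leffler argument, its terms are injective and thus projective, and maps from acyclic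
complexes still lift to it. This gives the right adjoint (`isLeftAdjoint_inclusion`). If `X` is the
projective resolution of a module `M`, one step suffices: the cocone `T` of the composite
quasi-isomorphism `X ⟶ M ⟶ I`, with `I` an injective resolution, is acyclic, and `I` is
K-injective. As couniversal maps are unique up to homotopy equivalence, the Tate Ext groups can be
computed with this `T`, whichever right adjoint is used (`nonempty_homCohomology_iso`).

It remains to compare `H^i Hom_A(T, N)` with Tate cohomology when `M = k` is the trivial module.
Both vanish on projective modules (`acyclic_homComplex`, `acyclic_tateComplex`) and have long exact
sequences, so by dimension shifting the comparison reduces to degree zero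
(`nonempty_homCohomology_iso_tateCohomology_of_zero`). There the cocycles of `T` in degree one form
a copy of `k`, with generator `x = d y`. Evaluation at `y` identifies the cocycles `T⁰ ⟶ N` with
the invariants `N^G`. The coboundaries are those which extend along `d : T⁰ ⟶ T¹`; since `x` is a
trace in the projective module `T¹`, and since `k[G]` is injective, they correspond to the image of
the norm (`nonempty_homCohomology_zero_iso`), and the quotient is the Tate cohomology group of
degree zero.
-/

noncomputable section

namespace TateExt

/-! ### Mapping cocones of maps to K-injective complexes -/

section

open Limits CochainComplex HomComplex

variable {C : Type*} [Category* C] [Abelian C]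

/-- A map `f : K ⟶ X` from an acyclic complex lifts to the cocone of `φ : X ⟶ I`, because `f ≫ φ`
is null-homotopic as `I` is K-injective. -/
lemma exists_lift_mappingCocone {K X I : CochainComplex C ℤ} (φ : X ⟶ I) [I.IsKInjective]
    (hK : K.Acyclic) (f : K ⟶ X) : ∃ g : K ⟶ mappingCocone φ, g ≫ mappingCocone.fst φ = f := by
  obtain ⟨β, hβ⟩ := IsKInjective.eq_δ_of_cocycle (Cocycle.ofHom (f ≫ φ)) hK (-1) (by simp)
  exact ⟨mappingCocone.lift φ f (-β) (by simp [hβ]), by simp⟩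

lemma mappingCocone_hom_ext {X I : CochainComplex C ℤ} (φ : X ⟶ I) {Z : C} {p : ℤ} (q : ℤ)
    (hpq : p + -1 = q) {f g : Z ⟶ (mappingCocone φ).X p}
    (h₁ : f ≫ (mappingCocone.fst φ).f p = g ≫ (mappingCocone.fst φ).f p)
    (h₂ : f ≫ (mappingCocone.snd φ).v p q hpq = g ≫ (mappingCocone.snd φ).v p q hpq) : f = g := by
  rw [← Category.comp_id f, ← Category.comp_id g, ← mappingCocone.id_X φ p q hpq,
    Preadditive.comp_add, Preadditive.comp_add, reassoc_of% h₁, reassoc_of% h₂]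

lemma ofHom_eq_liftCochain {K X I : CochainComplex C ℤ} (φ : X ⟶ I) (g : K ⟶ mappingCocone φ) :
    Cochain.ofHom g = mappingCocone.liftCochain φ (Cochain.ofHom (g ≫ mappingCocone.fst φ))
      ((Cochain.ofHom g).comp (mappingCocone.snd φ) (zero_add (-1))) (by simp) := by
  ext p
  apply mappingCocone_hom_ext φ (p + -1) rfl <;> simp

lemma inr_comp_snd_mappingCocone {X I : CochainComplex C ℤ} (φ : X ⟶ I) :
    (mappingCocone.inr φ).1.comp (mappingCocone.snd φ) (show (1 : ℤ) + -1 = 0 by simp) =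
        Cochain.ofHom (𝟙 I) := by
  ext p
  simp [Cochain.comp_v (n₁ := 1) (n₂ := -1) _ _ _ p (p+1) p rfl (by lia)]

/-- The projection of the cocone of `φ` to `I`, of degree `-1`, is a homotopy from zero to minus
the composite of `φ` with the projection to `X`. -/
lemma δ_snd_mappingCocone {X I : CochainComplex C ℤ} (φ : X ⟶ I) :
    δ (-1) 0 (mappingCocone.snd φ) = -Cochain.ofHom (mappingCocone.fst φ ≫ φ) := by
  have h1 : δ 0 1 (Cochain.ofHom (𝟙 (mappingCocone φ))) = 0 := by simp
  rw [ofHom_eq_liftCochain, mappingCocone.δ_liftCochain _ _ _ _ _ (zero_add 1)] at h1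
  simp only [δ_ofHom, Cochain.zero_comp, zero_sub, neg_eq_zero] at h1
  have h2 := congrArg (fun c => c.comp (mappingCocone.snd φ) (show (1 : ℤ) + -1 = 0 by simp)) h1
  simp only [Cochain.zero_comp] at h2
  rw [Cochain.comp_assoc _ _ _ (n₂₃ := 0) (zero_add 1) (by lia) (by lia),
    inr_comp_snd_mappingCocone] at h2
  simpa [eq_neg_iff_add_eq_zero] using h2

/-- A null-homotopy of the composite of `g : K ⟶ mappingCocone φ` with the projection to `X` is
itself the projection of a null-homotopy of `g`, when `K` is acyclic and the target of `φ` is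
K-injective. -/
lemma exists_cochain_lift_mappingCocone {K X I : CochainComplex C ℤ} (φ : X ⟶ I) [I.IsKInjective]
    (hK : K.Acyclic) (g : K ⟶ mappingCocone φ) (α : Cochain K X (-1))
    (hα : δ (-1) 0 α = Cochain.ofHom (g ≫ mappingCocone.fst φ)) :
    ∃ γ : Cochain K (mappingCocone φ) (-1), δ (-1) 0 γ = Cochain.ofHom g ∧
      γ.comp (Cochain.ofHom (mappingCocone.fst φ)) (add_zero _) = α := by
  set s : Cochain K I (-1) := (Cochain.ofHom g).comp (mappingCocone.snd φ) (zero_add (-1)) with hs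
  have hz : δ (-1) 0 (s + α.comp (Cochain.ofHom φ) (add_zero _)) = 0 := by
    rw [δ_add, δ_comp_ofHom, hα, hs, δ_ofHom_comp, δ_snd_mappingCocone]
    simp
  obtain ⟨β, hβ⟩ := IsKInjective.eq_δ_of_cocycle
    ⟨_, (Cocycle.mem_iff (-1) 0 (by simp) _).2 hz⟩ hK (-2) (by simp)
  refine ⟨mappingCocone.liftCochain φ α (-β) (by simp), ?_, by simp⟩
  rw [mappingCocone.δ_liftCochain _ _ _ _ _ (by simp), hα]
  simp only [δ_neg, hβ, hs, neg_add_rev]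
  ext p
  apply mappingCocone_hom_ext φ (p + -1) rfl
  · simp [Cochain.comp_v (n₁ := -1) (n₂ := 1) _ _ _ p (p + -1) p rfl (by lia)]
  · simp [Cochain.comp_v (n₁ := -1) (n₂ := 1) _ _ _ p (p + -1) p rfl (by lia)]

instance injective_mappingCocone_X {X I : CochainComplex C ℤ} (φ : X ⟶ I) (p : ℤ)
    [Injective (X.X p)] [∀ q, Injective (I.X q)] : Injective ((mappingCocone φ).X p) where
  factors f i _ := by
    refine ⟨Injective.factorThru (f ≫ (mappingCocone.fst φ).f p) i ≫
        (mappingCocone.inl φ).v p p (add_zero p) +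
      Injective.factorThru (f ≫ (mappingCocone.snd φ).v p (p + -1) rfl) i ≫
        (mappingCocone.inr φ).1.v (p + -1) p (by lia), ?_⟩
    rw [Preadditive.comp_add, Injective.comp_factorThru_assoc, Injective.comp_factorThru_assoc,
      Category.assoc, Category.assoc, ← Preadditive.comp_add, mappingCocone.id_X, Category.comp_id]

/-- The terms of the projection `mappingCocone φ ⟶ X` have the right lifting property with respect
to monomorphisms: each is a split epimorphism whose kernel is a term of `I`. -/
lemma hasLiftingProperty_mappingCocone_fst {X I : CochainComplex C ℤ} (φ : X ⟶ I) (p : ℤ)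
    [∀ q, Injective (I.X q)] {U V : C} (i : U ⟶ V) [Mono i] (f : U ⟶ (mappingCocone φ).X p)
    (g : V ⟶ X.X p) (h : f ≫ (mappingCocone.fst φ).f p = i ≫ g) :
    ∃ l : V ⟶ (mappingCocone φ).X p, i ≫ l = f ∧ l ≫ (mappingCocone.fst φ).f p = g := by
  refine ⟨g ≫ (mappingCocone.inl φ).v p p (add_zero p) +
      Injective.factorThru (f ≫ (mappingCocone.snd φ).v p (p + -1) rfl) i ≫
        (mappingCocone.inr φ).1.v (p + -1) p (by lia), ?_, by simp⟩
  rw [Preadditive.comp_add, Injective.comp_factorThru_assoc, ← reassoc_of% h,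
    Category.assoc, ← Preadditive.comp_add, mappingCocone.id_X, Category.comp_id]

end

/-! ### Inverse limits of towers of complexes of modules -/

section

open Limits CochainComplex HomComplex

/-- Recursive choice of a sequence whose consecutive terms are related by `R`. -/
lemma exists_seq_of_step {α : ℕ → Type*} (P : ∀ n, α n → Prop) (R : ∀ n, α n → α (n + 1) → Prop)
    (a₀ : α 0) (h₀ : P 0 a₀) (hs : ∀ n a, P n a → ∃ b, P (n + 1) b ∧ R n a b) :
    ∃ s : ∀ n, α n, s 0 = a₀ ∧ ∀ n, P n (s n) ∧ R n (s n) (s (n + 1)) := by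
  choose f hf using hs
  let t : ∀ n, { a : α n // P n a } := fun n =>
    Nat.rec ⟨a₀, h₀⟩ (fun n a => ⟨f n a.1 a.2, (hf n a.1 a.2).1⟩) n
  exact ⟨fun n => (t n).1, rfl, fun n => ⟨(t n).2, (hf n (t n).1 (t n).2).2⟩⟩

section Modules

variable {A : Type u} [Ring A]

/-- The inverse limit of a tower of modules `⋯ ⟶ M 2 ⟶ M 1 ⟶ M 0`, as the submodule of compatible
sequences in the product. -/
def seqLimit (M : ℕ → ModuleCat.{u} A) (p : ∀ n, M (n + 1) ⟶ M n) : ModuleCat.{u} A :=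
  ModuleCat.of A
    { carrier := { x : ∀ n, M n | ∀ n, (p n).hom (x (n + 1)) = x n }
      add_mem' := fun hx hy n => by simp [hx n, hy n]
      zero_mem' := fun n => by simp
      smul_mem' := fun a x hx n => by simp [hx n] : Submodule A (∀ n, M n) }

namespace seqLimit

variable {M : ℕ → ModuleCat.{u} A} {p : ∀ n, M (n + 1) ⟶ M n}

/-- The projection of the inverse limit to a module of the tower. -/
def π (n : ℕ) : seqLimit M p ⟶ M n :=
  ModuleCat.ofHom (LinearMap.proj n ∘ₗ Submodule.subtype _)

lemma π_comp (n : ℕ) : π (p := p) (n + 1) ≫ p n = π n := by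
  ext x
  exact x.2 n

lemma hom_ext {Z : ModuleCat.{u} A} {f g : Z ⟶ seqLimit M p} (h : ∀ n, f ≫ π n = g ≫ π n) :
    f = g := by
  ext z
  apply Subtype.ext
  funext n
  exact ConcreteCategory.congr_hom (h n) z

/-- The map to the inverse limit defined by a compatible family of maps. -/
def lift {Z : ModuleCat.{u} A} (f : ∀ n, Z ⟶ M n) (hf : ∀ n, f (n + 1) ≫ p n = f n) :
    Z ⟶ seqLimit M p :=
  ModuleCat.ofHom (LinearMap.codRestrict _ (LinearMap.pi fun n => (f n).hom)
    fun z n => ConcreteCategory.congr_hom (hf n) z)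

@[simp]
lemma lift_π {Z : ModuleCat.{u} A} (f : ∀ n, Z ⟶ M n) (hf : ∀ n, f (n + 1) ≫ p n = f n) (n : ℕ) :
    lift f hf ≫ π n = f n := rfl

@[simp]
lemma lift_π_assoc {Z W : ModuleCat.{u} A} (f : ∀ n, Z ⟶ M n) (hf : ∀ n, f (n + 1) ≫ p n = f n)
    (n : ℕ) (g : M n ⟶ W) : lift f hf ≫ π n ≫ g = f n ≫ g := rfl

/-- An inverse limit is injective if the first module of the tower is, and the transition maps
have the right lifting property with respect to monomorphisms. -/
lemma injective [Injective (M 0)]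
    (h : ∀ n {U V : ModuleCat.{u} A} (i : U ⟶ V) [Mono i] (f : U ⟶ M (n + 1)) (g : V ⟶ M n),
      f ≫ p n = i ≫ g → ∃ l : V ⟶ M (n + 1), i ≫ l = f ∧ l ≫ p n = g) :
    Injective (seqLimit M p) where
  factors {U V} f i _ := by
    obtain ⟨s, -, hs⟩ := exists_seq_of_step (α := fun n => V ⟶ M n) (fun n g => i ≫ g = f ≫ π n)
      (fun n g l => l ≫ p n = g) _ (Injective.comp_factorThru _ _)
      (fun n g hg => h n i (f ≫ π (n + 1)) g (by rw [hg, Category.assoc, π_comp]))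
    exact ⟨lift s fun n => (hs n).2, hom_ext fun n => by simp [(hs n).1]⟩

end seqLimit

/-- The inverse limit of a tower of complexes of modules, formed degree by degree. -/
def towerLimit (X : ℕ → CochainComplex (ModuleCat.{u} A) ℤ) (p : ∀ n, X (n + 1) ⟶ X n) :
    CochainComplex (ModuleCat.{u} A) ℤ where
  X i := seqLimit (fun n => (X n).X i) (fun n => (p n).f i)
  d i j := seqLimit.lift (fun n => seqLimit.π n ≫ (X n).d i j) fun n => by
    rw [Category.assoc, ← (p n).comm, ← Category.assoc]
    exact congrArg (· ≫ (X n).d i j) (seqLimit.π_comp n)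
  shape i j h := seqLimit.hom_ext fun n => by simp [(X n).shape i j h]
  d_comp_d' i j k _ _ := seqLimit.hom_ext fun n => by simp

namespace towerLimit

variable (X : ℕ → CochainComplex (ModuleCat.{u} A) ℤ) (p : ∀ n, X (n + 1) ⟶ X n)

/-- The projection of the inverse limit to a complex of the tower. -/
@[simps]
def π (n : ℕ) : towerLimit X p ⟶ X n where
  f i := seqLimit.π n
  comm' i j _ := by simp [towerLimit]

lemma π_comp (n : ℕ) : π X p (n + 1) ≫ p n = π X p n := by
  ext1 i
  exact seqLimit.π_comp n

variable {X p}

lemma exists_lift {K : CochainComplex (ModuleCat.{u} A) ℤ} (f : ∀ n, K ⟶ X n)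
    (hf : ∀ n, f (n + 1) ≫ p n = f n) : ∃ g : K ⟶ towerLimit X p, ∀ n, g ≫ π X p n = f n := by
  refine ⟨{ f := fun i => seqLimit.lift (fun n => (f n).f i)
              fun n => HomologicalComplex.congr_hom (hf n) i
            comm' := fun i j _ => seqLimit.hom_ext fun n => ?_ }, fun n => ?_⟩
  · exact (f n).comm i j
  · ext1 i
    rfl

lemma exists_cochain_lift {K : CochainComplex (ModuleCat.{u} A) ℤ} {m : ℤ}
    (α : ∀ n, Cochain K (X n) m)
    (hα : ∀ n, (α (n + 1)).comp (Cochain.ofHom (p n)) (add_zero m) = α n) :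
    ∃ β : Cochain K (towerLimit X p) m,
      ∀ n, β.comp (Cochain.ofHom (π X p n)) (add_zero m) = α n := by
  refine ⟨Cochain.mk fun i j hij => seqLimit.lift (fun n => (α n).v i j hij) fun n => ?_,
    fun n => ?_⟩
  · simp [← hα n]
  · ext i j hij : 1
    rw [Cochain.comp_zero_cochain_v, Cochain.ofHom_v]
    rfl

lemma cochain_ext {K : CochainComplex (ModuleCat.{u} A) ℤ} {m : ℤ}
    {α β : Cochain K (towerLimit X p) m}
    (h : ∀ n, α.comp (Cochain.ofHom (π X p n)) (add_zero m) =
      β.comp (Cochain.ofHom (π X p n)) (add_zero m)) : α = β := by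
  ext i j hij : 1
  refine seqLimit.hom_ext fun n => ?_
  have := Cochain.congr_v (h n) i j hij
  rw [Cochain.comp_zero_cochain_v, Cochain.comp_zero_cochain_v, Cochain.ofHom_v] at this
  exact this

/-- The inverse limit of a tower of degreewise surjective maps is acyclic if each transition map
sends cocycles to coboundaries. In a compatible family of cocycles, the `n`-th one bounds some
`w n`, and the `w n` become compatible up to coboundaries once each is replaced by the image of
`w (n + 1)`. As the transition maps are surjective, these coboundaries can be corrected recursively
along the tower, as in the Mittag-Leffler criterion. -/
lemma acyclic (hsurj : ∀ n i, Function.Surjective ((p n).f i).hom)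
    (hzero : ∀ n i (z : (X (n + 1)).X i), ((X (n + 1)).d i (i + 1)).hom z = 0 →
      ∃ w : (X n).X (i - 1), ((X n).d (i - 1) i).hom w = ((p n).f i).hom z) :
    (towerLimit X p).Acyclic := by
  intro i
  rw [HomologicalComplex.exactAt_iff' _ (i - 1) i (i + 1) (by simp) (by simp),
    ShortComplex.moduleCat_exact_iff]
  intro z hz
  have hd : ∀ n i j (x : (X (n + 1)).X i),
      ((p n).f j).hom (((X (n + 1)).d i j).hom x) = ((X n).d i j).hom (((p n).f i).hom x) := by
    intro n i j x
    exact (ConcreteCategory.congr_hom ((p n).comm i j) x).symm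
  have hzn : ∀ n, ((X n).d i (i + 1)).hom (z.1 n) = 0 := fun n =>
    congrArg (fun y : (towerLimit X p).X (i + 1) => y.1 n) hz
  have hz2 : ∀ n, ((p n).f i).hom (z.1 (n + 1)) = z.1 n := z.2
  have hw : ∀ n, ∃ w : (X n).X (i - 1), ((X n).d (i - 1) i).hom w = z.1 n := fun n => by
    obtain ⟨w, hw⟩ := hzero n i (z.1 (n + 1)) (hzn _)
    exact ⟨w, hw.trans (hz2 n)⟩
  choose w hw using hw
  -- after one transition map the differences of the `w'` are coboundaries, not just cocycles
  let w' : ∀ n, (X n).X (i - 1) := fun n => ((p n).f (i - 1)).hom (w (n + 1))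
  have hw' : ∀ n, ((X n).d (i - 1) i).hom (w' n) = z.1 n := fun n => by
    rw [← hd, hw, hz2]
  have hv : ∀ n, ∃ v : (X n).X (i - 1 - 1), ((X n).d (i - 1 - 1) (i - 1)).hom v =
      ((p n).f (i - 1)).hom (w' (n + 1)) - w' n := fun n => by
    obtain ⟨v, hv⟩ := hzero n (i - 1) (w' (n + 1) - w (n + 1)) (by
      rw [sub_add_cancel, map_sub, hw', hw, sub_self])
    exact ⟨v, by rw [hv, map_sub]⟩
  choose v hv using hv
  obtain ⟨t, -, ht⟩ := exists_seq_of_step (α := fun n => (X n).X (i - 1 - 1)) (fun _ _ => True)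
    (fun n a b => ((p n).f (i - 1 - 1)).hom b = a - v n) 0 trivial
    (fun n a _ => (hsurj n _ (a - v n)).imp fun _ h => ⟨trivial, h⟩)
  refine ⟨⟨fun n => w' n + ((X n).d (i - 1 - 1) (i - 1)).hom (t n), fun n => ?_⟩, ?_⟩
  · change ((p n).f (i - 1)).hom (w' (n + 1) + _) = _
    rw [map_add, hd, (ht n).2, map_sub, hv]
    have aux (a b c : (X n).X (i - 1)) : a + (b - (a - c)) = c + b := by abel
    exact aux _ _ _
  · apply Subtype.ext
    funext n
    change ((X n).d (i - 1) i).hom (w' n + ((X n).d (i - 1 - 1) (i - 1)).hom (t n)) = z.1 n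
    rw [map_add, hw']
    simp [← ModuleCat.comp_apply]

end towerLimit

end Modules

end

/-! ### K-injective complexes over a field and their images under right adjoints -/

section

open Limits CochainComplex HomComplex

section

variable {C D : Type*} [Category* C] [Category* D] [Abelian C] [Abelian D]

lemma acyclic_mapHomologicalComplex (F : C ⥤ D) [F.Additive]
    [PreservesFiniteLimits F] [PreservesFiniteColimits F] {ι : Type*} {c : ComplexShape ι}
    {K : HomologicalComplex C c} (hK : K.Acyclic) :
    HomologicalComplex.Acyclic ((F.mapHomologicalComplex c).obj K) := fun i => by
  have := hK i
  rw [HomologicalComplex.exactAt_iff] at this ⊢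
  exact this.map F

/-- The unit of an adjunction, applied to a complex. -/
@[simps]
def unitComplex {F : C ⥤ D} {G : D ⥤ C} (adj : F ⊣ G) [F.Additive] [G.Additive]
    {ι : Type*} {c : ComplexShape ι} (K : HomologicalComplex C c) :
    K ⟶ (G.mapHomologicalComplex c).obj ((F.mapHomologicalComplex c).obj K) where
  f i := adj.unit.app (K.X i)
  comm' i j _ := (adj.unit.naturality (K.d i j)).symm

/-- An additive right adjoint of an exact functor preserves K-injective complexes. -/
lemma isKInjective_mapHomologicalComplex {F : C ⥤ D} {G : D ⥤ C} (adj : F ⊣ G) [F.Additive]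
    [G.Additive] [PreservesFiniteLimits F] [PreservesFiniteColimits F]
    (L : CochainComplex D ℤ) [L.IsKInjective] :
    CochainComplex.IsKInjective ((G.mapHomologicalComplex (ComplexShape.up ℤ)).obj L) where
  nonempty_homotopy_zero {K} f hK := by
    let f' : (F.mapHomologicalComplex _).obj K ⟶ L :=
      { f := fun i => (adj.homEquiv _ _).symm (f.f i)
        comm' := fun i j _ => by
          refine (adj.homEquiv_naturality_right_symm (f.f i) (L.d i j)).symm.trans ?_
          exact (congrArg _ (f.comm i j)).trans (adj.homEquiv_naturality_left_symm _ _) }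
    have hf : f = unitComplex adj K ≫ (G.mapHomologicalComplex _).map f' := by
      ext1 i
      exact ((adj.homEquiv_unit _ _ _).symm.trans
        ((adj.homEquiv _ _).apply_symm_apply (f.f i))).symm
    obtain ⟨h⟩ := IsKInjective.nonempty_homotopy_zero f' (acyclic_mapHomologicalComplex F hK)
    exact ⟨(Homotopy.ofEq hf).trans (((G.mapHomotopy h).compLeft (unitComplex adj K)).trans
      (Homotopy.ofEq (by simp)))⟩

end

/-- Over a field every complex is K-injective: an acyclic complex `K` is split, hence
contractible, so all maps from `K` are null-homotopic. -/
instance isKInjective_of_field {k : Type u} [Field k] (L : CochainComplex (ModuleCat.{u} k) ℤ) :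
    L.IsKInjective where
  nonempty_homotopy_zero {K} f hK := by
    have hK' : ∀ i j l : ℤ, i + 1 = j → j + 1 = l → ∀ x : K.X j, (K.d j l).hom x = 0 →
        ∃ y : K.X i, (K.d i j).hom y = x := by
      intro i j l hij hjl x hx
      have := (K.exactAt_iff' i j l (by simp; lia) (by simp; lia)).1 (hK j)
      rw [ShortComplex.moduleCat_exact_iff] at this
      exact this x hx
    -- `q i j` is a generalized inverse of the differential `d i j`
    have hq : ∀ i j, ∃ q : K.X j →ₗ[k] K.X i,
        ∀ x, (K.d i j).hom (q ((K.d i j).hom x)) = (K.d i j).hom x := by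
      intro i j
      obtain ⟨s, hs⟩ := (K.d i j).hom.rangeRestrict.exists_rightInverse_of_surjective
        (LinearMap.range_rangeRestrict _)
      obtain ⟨q, hq⟩ := s.exists_extend
      refine ⟨q, fun x => ?_⟩
      have h1 : q ((K.d i j).hom x) = s ((K.d i j).hom.rangeRestrict x) :=
        LinearMap.congr_fun hq ((K.d i j).hom.rangeRestrict x)
      rw [h1]
      exact congrArg Subtype.val (LinearMap.congr_fun hs _)
    choose q hq using hq
    have hdd : ∀ i j l x, (K.d j l).hom ((K.d i j).hom x) = 0 := fun i j l x =>
      ConcreteCategory.congr_hom (K.d_comp_d i j l) x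
    -- `1 - d q` kills the boundaries, so that `(1 - d q) q` is a contraction
    have hb : ∀ i j l : ℤ, i + 1 = j → j + 1 = l → ∀ x : K.X j, (K.d j l).hom x = 0 →
        (K.d i j).hom (q i j x) = x := by
      intro i j l hij hjl x hx
      obtain ⟨y, rfl⟩ := hK' i j l hij hjl x hx
      exact hq _ _ _
    let c : Cochain K K (-1) := Cochain.mk fun i j hij => ModuleCat.ofHom
      (q j i - (K.d (j - 1) j).hom ∘ₗ q (j - 1) j ∘ₗ q j i)
    have hc : δ (-1) 0 c = Cochain.ofHom (𝟙 K) := by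
      ext i x
      rw [δ_v (-1) 0 (by simp) _ i i (by simp) (i - 1) (i + 1) (by simp) (by simp)]
      have h1 := hb (i - 1) i (i + 1) (by simp) rfl
        (x - q i (i + 1) ((K.d i (i + 1)).hom x)) (by rw [map_sub, hq, sub_self])
      simp only [map_sub] at h1
      simp [c, hdd]
      rw [add_sub_left_comm, h1, add_sub_cancel]
    refine ⟨(Cochain.equivHomotopy f 0).symm ⟨c.comp (Cochain.ofHom f) (add_zero _), ?_⟩⟩
    simp [δ_comp_ofHom, hc, ← Cochain.ofHom_comp]

end

/-! ### Couniversal maps from acyclic complexes -/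

section

open Limits CochainComplex HomComplex

variable {k A : Type u} [Field k] [Ring A] (f : k →+* A)

instance : (ModuleCat.coextendScalars.{_,_,u} f).Additive :=
  (ModuleCat.restrictCoextendScalarsAdj f).right_adjoint_additive

instance (M : ModuleCat.{u} k) : Injective M :=
  have := Module.injective_of_isSemisimpleRing k M
  Module.injective_object_of_injective_module k M

instance preservesFiniteLimits_restrictScalars :
    PreservesFiniteLimits (ModuleCat.restrictScalars.{u} f) :=
  ⟨fun _ _ _ => ⟨fun {_} => inferInstance⟩⟩

instance preservesFiniteColimits_restrictScalars :
    PreservesFiniteColimits (ModuleCat.restrictScalars.{u} f) :=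
  ⟨fun _ _ _ => ⟨fun {_} => inferInstance⟩⟩

/-- The complex of coinduced modules `Hom_k(A, X)`, for a complex `X` of `A`-modules and a ring
homomorphism `f : k →+* A`. -/
abbrev coindComplex (X : CochainComplex (ModuleCat.{u} A) ℤ) : CochainComplex (ModuleCat.{u} A) ℤ :=
  ((ModuleCat.coextendScalars f).mapHomologicalComplex _).obj
    (((ModuleCat.restrictScalars f).mapHomologicalComplex _).obj X)

/-- The canonical embedding of `X` into `Hom_k(A, X)`, which sends `x` to the map `a ↦ a x`. -/
abbrev toCoind (X : CochainComplex (ModuleCat.{u} A) ℤ) : X ⟶ coindComplex f X :=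
  unitComplex (ModuleCat.restrictCoextendScalarsAdj f) X

instance (X : CochainComplex (ModuleCat.{u} A) ℤ) : (coindComplex f X).IsKInjective :=
  isKInjective_mapHomologicalComplex (ModuleCat.restrictCoextendScalarsAdj f) _

instance (X : CochainComplex (ModuleCat.{u} A) ℤ) (i : ℤ) : Injective ((coindComplex f X).X i) :=
  Injective.injective_of_adjoint (ModuleCat.restrictCoextendScalarsAdj f)
    ((ModuleCat.restrictScalars f).obj (X.X i))

/-- The evaluation `h ↦ h 1` on the coinduced complex. It is `k`-linear and commutes with the
differentials, and it is a retraction of the embedding `toCoind`; only its additivity is recorded.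
-/
def evalOne (X : CochainComplex (ModuleCat.{u} A) ℤ) (i : ℤ) : (coindComplex f X).X i →+ X.X i :=
  ((ModuleCat.restrictCoextendScalarsAdj f).counit.app
    ((ModuleCat.restrictScalars f).obj (X.X i))).hom.toAddMonoidHom

lemma evalOne_toCoind (X : CochainComplex (ModuleCat.{u} A) ℤ) (i : ℤ) (x : X.X i) :
    evalOne f X i (((toCoind f X).f i).hom x) = x :=
  ConcreteCategory.congr_hom
    ((ModuleCat.restrictCoextendScalarsAdj f).left_triangle_components (X.X i)) x

lemma evalOne_d (X : CochainComplex (ModuleCat.{u} A) ℤ) (i j : ℤ) (x : (coindComplex f X).X i) :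
    evalOne f X j (((coindComplex f X).d i j).hom x) = (X.d i j).hom (evalOne f X i x) :=
  ConcreteCategory.congr_hom ((ModuleCat.restrictCoextendScalarsAdj f).counit.naturality
    ((ModuleCat.restrictScalars f).map (X.d i j))) x

/-- The `I`-component of a cocycle in the cocone of `φ : X ⟶ I` bounds minus the image of its
`X`-component. -/
lemma d_snd_mappingCocone_of_d_eq_zero {X I : CochainComplex (ModuleCat.{u} A) ℤ}
    (φ : X ⟶ I) (i : ℤ)
    (z : (mappingCocone φ).X i) (hz : ((mappingCocone φ).d i (i + 1)).hom z = 0) :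
    (I.d (i - 1) i).hom (((mappingCocone.snd φ).v i (i - 1) (by lia)).hom z) =
      - (φ.f i).hom (((mappingCocone.fst φ).f i).hom z) := by
  have h := Cochain.congr_v (δ_snd_mappingCocone φ) i i (add_zero i)
  rw [δ_v (-1) 0 (by simp) _ i i (by simp) (i - 1) (i + 1) (by simp) (by simp)] at h
  simpa [hz] using ConcreteCategory.congr_hom h z

/-- The projection from the cocone of `X ⟶ Hom_k(A, X)` to `X` sends cocycles to coboundaries: it
is zero in the homotopy category of complexes over `k`, as the embedding is split there by
`evalOne`. -/
lemma exists_d_eq_fst_of_d_eq_zero (X : CochainComplex (ModuleCat.{u} A) ℤ) (i : ℤ)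
    (z : (mappingCocone (toCoind f X)).X i)
    (hz : ((mappingCocone (toCoind f X)).d i (i + 1)).hom z = 0) :
    ∃ w : X.X (i - 1), (X.d (i - 1) i).hom w = ((mappingCocone.fst (toCoind f X)).f i).hom z := by
  refine ⟨- evalOne f X (i - 1)
    (((mappingCocone.snd (toCoind f X)).v i (i - 1) (by lia)).hom z), ?_⟩
  rw [map_neg, ← evalOne_d, d_snd_mappingCocone_of_d_eq_zero _ i z hz, map_neg,
    evalOne_toCoind, neg_neg]

/-- The tower in which each complex is the cocone of the embedding of the previous one into its
coinduced complex. -/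
def coindTower (X : CochainComplex (ModuleCat.{u} A) ℤ) : ℕ → CochainComplex (ModuleCat.{u} A) ℤ
  | 0 => X
  | n + 1 => mappingCocone (toCoind f (coindTower X n))

/-- The transition maps of the tower `coindTower`. -/
abbrev coindTowerMap (X : CochainComplex (ModuleCat.{u} A) ℤ) (n : ℕ) :
    coindTower f X (n + 1) ⟶ coindTower f X n :=
  mappingCocone.fst (toCoind f (coindTower f X n))

/-- The inverse limit of the tower `coindTower`: an acyclic complex which is couniversal among the
acyclic complexes over `X`. -/
abbrev acyclicCover (X : CochainComplex (ModuleCat.{u} A) ℤ) : CochainComplex (ModuleCat.{u} A) ℤ :=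
  towerLimit (coindTower f X) (coindTowerMap f X)

/-- The couniversal map from the acyclic complex `acyclicCover f X` to `X`. -/
abbrev acyclicCoverπ (X : CochainComplex (ModuleCat.{u} A) ℤ) : acyclicCover f X ⟶ X :=
  towerLimit.π (coindTower f X) (coindTowerMap f X) 0

lemma acyclic_acyclicCover (X : CochainComplex (ModuleCat.{u} A) ℤ) :
    (acyclicCover f X).Acyclic :=
  towerLimit.acyclic
    (fun n i x => ⟨((mappingCocone.inl (toCoind f (coindTower f X n))).v i i (add_zero i)).hom x,
      ConcreteCategory.congr_hom
        (mappingCocone.inl_v_fst_f (toCoind f (coindTower f X n)) i) x⟩)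
    (fun n i z hz => exists_d_eq_fst_of_d_eq_zero f (coindTower f X n) i z hz)

lemma injective_acyclicCover (X : CochainComplex (ModuleCat.{u} A) ℤ) (i : ℤ)
    [hX : Injective (X.X i)] : Injective ((acyclicCover f X).X i) :=
  have : Injective ((coindTower f X 0).X i) := hX
  seqLimit.injective fun n _ _ j _ g h w =>
    hasLiftingProperty_mappingCocone_fst (toCoind f (coindTower f X n)) i j g h w

/-- The map `p : T ⟶ X` is, up to homotopy, a couniversal map from an acyclic complex to `X`. The
last two fields imply that composition with `p` is a bijection from homotopy classes of maps
`K ⟶ T` to homotopy classes of maps `K ⟶ X`, for each acyclic complex `K`; the first of them asks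
for lifts on the nose, and not only up to homotopy. -/
structure IsAcyclicCoreflection {T X : CochainComplex (ModuleCat.{u} A) ℤ} (p : T ⟶ X) : Prop where
  acyclic : T.Acyclic
  exists_lift : ∀ {K : CochainComplex (ModuleCat.{u} A) ℤ}, K.Acyclic → ∀ g : K ⟶ X,
    ∃ g' : K ⟶ T, g' ≫ p = g
  homotopy_lift : ∀ {K : CochainComplex (ModuleCat.{u} A) ℤ}, K.Acyclic → ∀ g : K ⟶ T,
    Nonempty (Homotopy (g ≫ p) 0) → Nonempty (Homotopy g 0)

lemma nonempty_homotopy_zero_iff {C : Type*} [Category* C] [Preadditive C]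
    {K L : CochainComplex C ℤ} (g : K ⟶ L) :
    Nonempty (Homotopy g 0) ↔ ∃ α : Cochain K L (-1), δ (-1) 0 α = Cochain.ofHom g := by
  constructor
  · rintro ⟨h⟩
    obtain ⟨α, hα⟩ := Cochain.equivHomotopy _ _ h
    exact ⟨α, by simpa using hα.symm⟩
  · rintro ⟨α, hα⟩
    exact ⟨(Cochain.equivHomotopy _ _).symm ⟨α, by simp [hα]⟩⟩

lemma isAcyclicCoreflection_mappingCocone {X I : CochainComplex (ModuleCat.{u} A) ℤ} (φ : X ⟶ I)
    [I.IsKInjective] (h : (mappingCocone φ).Acyclic) :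
    IsAcyclicCoreflection (mappingCocone.fst φ) where
  acyclic := h
  exists_lift hK g := exists_lift_mappingCocone φ hK g
  homotopy_lift hK g hg := by
    rw [nonempty_homotopy_zero_iff] at hg ⊢
    obtain ⟨α, hα⟩ := hg
    obtain ⟨γ, hγ, _⟩ := exists_cochain_lift_mappingCocone φ hK g α hα
    exact ⟨γ, hγ⟩

lemma isAcyclicCoreflection_acyclicCoverπ (X : CochainComplex (ModuleCat.{u} A) ℤ) :
    IsAcyclicCoreflection (acyclicCoverπ f X) where
  acyclic := acyclic_acyclicCover f X
  exists_lift {K} hK g := by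
    obtain ⟨s, hs₀, hs⟩ := exists_seq_of_step (α := fun n => K ⟶ coindTower f X n)
      (fun _ _ => True) (fun n a b => b ≫ coindTowerMap f X n = a) g trivial
      (fun n a _ => (exists_lift_mappingCocone (toCoind f (coindTower f X n)) hK a).imp
        fun _ h => ⟨trivial, h⟩)
    obtain ⟨g', hg'⟩ := towerLimit.exists_lift s (fun n => (hs n).2)
    exact ⟨g', (hg' 0).trans hs₀⟩
  homotopy_lift {K} hK g hg := by
    rw [nonempty_homotopy_zero_iff] at hg ⊢
    obtain ⟨a, ha⟩ := hg
    obtain ⟨s, -, hs⟩ := exists_seq_of_step (α := fun n => Cochain K (coindTower f X n) (-1))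
      (fun n a => δ (-1) 0 a = Cochain.ofHom (g ≫ towerLimit.π _ (coindTowerMap f X) n))
      (fun n a b => b.comp (Cochain.ofHom (coindTowerMap f X n)) (add_zero _) = a) a ha
      (fun n a ha => exists_cochain_lift_mappingCocone (toCoind f (coindTower f X n)) hK
        (g ≫ towerLimit.π _ (coindTowerMap f X) (n + 1)) a
          (ha.trans (congrArg Cochain.ofHom
            ((congrArg (g ≫ ·) (towerLimit.π_comp _ (coindTowerMap f X) n).symm).trans
              (Category.assoc _ _ _).symm))))
    obtain ⟨β, hβ⟩ := towerLimit.exists_cochain_lift s (fun n => (hs n).2)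
    refine ⟨β, towerLimit.cochain_ext fun n => ?_⟩
    rw [← δ_comp_ofHom, hβ, (hs n).1, Cochain.ofHom_comp]

end

/-! ### Higman's criterion: projective and injective modules over a group algebra -/

section

open scoped TensorProduct MonoidAlgebra

section Higman

variable {k G : Type*} [Field k] [Group G] [Fintype G]
  {M N P : Type*} [AddCommGroup M] [Module k M] [Module k[G] M] [IsScalarTower k k[G] M]
  [AddCommGroup N] [Module k N] [Module k[G] N] [IsScalarTower k k[G] N]
  [AddCommGroup P] [Module k P] [Module k[G] P] [IsScalarTower k k[G] P]

variable (k G M) in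
/-- Higman's criterion: the identity of `M` is the trace `∑ g, g⁻¹ θ g` of a `k`-linear
endomorphism `θ` of `M`. -/
def HasUnitTrace : Prop :=
  ∃ θ : M →ₗ[k] M, ∀ m, ∑ g : G, θ.conjugate g m = m

lemma sum_conjugate_comp_left (f : N →ₗ[k[G]] P) (h : M →ₗ[k] N) (m : M) :
    ∑ g : G, ((f.restrictScalars k) ∘ₗ h).conjugate g m = f (∑ g : G, h.conjugate g m) := by
  simp [LinearMap.conjugate_apply]

lemma sum_conjugate_comp_right (h : N →ₗ[k] P) (f : M →ₗ[k[G]] N) (m : M) :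
    ∑ g : G, (h ∘ₗ (f.restrictScalars k)).conjugate g m = ∑ g : G, h.conjugate g (f m) := by
  simp [LinearMap.conjugate_apply]

lemma HasUnitTrace.of_retract (i : M →ₗ[k[G]] N) (r : N →ₗ[k[G]] M) (hr : ∀ m, r (i m) = m)
    (h : HasUnitTrace k G N) : HasUnitTrace k G M := by
  obtain ⟨θ, hθ⟩ := h
  refine ⟨(r.restrictScalars k) ∘ₗ θ ∘ₗ (i.restrictScalars k), fun m => ?_⟩
  rw [sum_conjugate_comp_left, sum_conjugate_comp_right, hθ, hr]

/-- On `k[G]` the identity is the trace of the projection to the line spanned by `1`; a free module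
is treated coordinate by coordinate. -/
lemma hasUnitTrace_finsupp (S : Type*) : HasUnitTrace k G (S →₀ k[G]) := by
  classical
  -- the projection of `k[G]` to the line spanned by `1`
  let e : k[G] →ₗ[k] k[G] := MonoidAlgebra.lsingle (1 : G) ∘ₗ Finsupp.lapply 1 ∘ₗ
    (MonoidAlgebra.coeffLinearEquiv k).toLinearMap
  have he (x : G) (c : k) : e (MonoidAlgebra.single x c) =
      if x = 1 then MonoidAlgebra.single x c else 0 := by
    by_cases hx : x = 1 <;> simp [e, MonoidAlgebra.coeffLinearEquiv, hx]
  refine ⟨Finsupp.mapRange.linearMap e, fun m => ?_⟩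
  induction m using Finsupp.induction_linear with
  | zero => simp [LinearMap.conjugate_apply]
  | add f g hf hg => simp only [map_add, Finset.sum_add_distrib, hf, hg]
  | single s a =>
    induction a using MonoidAlgebra.induction_linear with
    | zero => simp [LinearMap.conjugate_apply]
    | add f g hf hg => simp only [Finsupp.single_add, map_add, Finset.sum_add_distrib, hf, hg]
    | single x c =>
      simp only [LinearMap.conjugate_apply, Finsupp.smul_single, smul_eq_mul,
        MonoidAlgebra.single_mul_single, one_mul, Finsupp.mapRange.linearMap_apply,
        Finsupp.mapRange_single, he]
      rw [Finset.sum_eq_single x⁻¹]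
      · simp
      · intro b _ hb
        rw [if_neg fun h => hb (eq_inv_of_mul_eq_one_left h)]
        simp
      · simp

lemma hasUnitTrace_of_projective [Module.Projective k[G] M] : HasUnitTrace k G M := by
  obtain ⟨s, hs⟩ := Module.projective_def'.1 (inferInstance : Module.Projective k[G] M)
  exact (hasUnitTrace_finsupp M).of_retract s (Finsupp.linearCombination k[G] id) fun m =>
    LinearMap.congr_fun hs m

/-- Relative injectivity: a `k`-linear extension of an equivariant map becomes equivariant, and
remains an extension, when it is composed with `θ` and averaged over the group. -/
lemma HasUnitTrace.exists_extension (hP : HasUnitTrace k G P) (i : M →ₗ[k[G]] N)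
    (hi : Function.Injective i) (f : M →ₗ[k[G]] P) : ∃ h : N →ₗ[k[G]] P, ∀ m, h (i m) = f m := by
  obtain ⟨θ, hθ⟩ := hP
  obtain ⟨r, hr⟩ := (i.restrictScalars k).exists_leftInverse_of_injective
    (LinearMap.ker_eq_bot.2 hi)
  refine ⟨(θ ∘ₗ (f.restrictScalars k) ∘ₗ r).sumOfConjugatesEquivariant G, fun m => ?_⟩
  have hr' : r ∘ₗ (i.restrictScalars k) = LinearMap.id := hr
  rw [LinearMap.sumOfConjugatesEquivariant_apply, ← sum_conjugate_comp_right, LinearMap.comp_assoc,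
    LinearMap.comp_assoc, hr', LinearMap.comp_id, sum_conjugate_comp_right, hθ]

variable (k G M) in
/-- The equivariant embedding `m ↦ ∑ g, g ⊗ g⁻¹ m` of `M` into a free module. -/
def toInduced : M →ₗ[k[G]] k[G] ⊗[k] M :=
  MonoidAlgebra.equivariantOfLinearOfComm
    (∑ g : G, TensorProduct.mk k k[G] M (MonoidAlgebra.single g 1) ∘ₗ
      MonoidAlgebra.GroupSMul.linearMap k M g⁻¹)
    fun g m => by
      simp only [LinearMap.sum_apply, LinearMap.comp_apply, Finset.smul_sum,
        MonoidAlgebra.GroupSMul.linearMap_apply, TensorProduct.mk_apply, TensorProduct.smul_tmul']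
      refine Fintype.sum_bijective (g⁻¹ * ·) (Group.mulLeft_bijective g⁻¹) _ _ fun i ↦ ?_
      simp [smul_smul, MonoidAlgebra.single_mul_single]

lemma toInduced_injective : Function.Injective (toInduced k G M) := by
  classical
  let c : k[G] →ₗ[k] k := Finsupp.lapply (1 : G) ∘ₗ (MonoidAlgebra.coeffLinearEquiv k).toLinearMap
  refine Function.LeftInverse.injective
    (g := TensorProduct.lid k M ∘ LinearMap.rTensor M c) fun m => ?_
  have hc (x : G) : c (MonoidAlgebra.single x 1) = if x = 1 then 1 else 0 := by
    by_cases hx : x = 1 <;> simp [c, MonoidAlgebra.coeffLinearEquiv, hx]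
  simp [toInduced, LinearMap.sum_apply, hc, ite_smul, ← MonoidAlgebra.one_def]

end Higman

section ModuleCat

open scoped ModuleCat
variable {k G : Type u} [Field k] [Group G] [Fintype G]

lemma hasUnitTrace_of_projective_moduleCat (M : ModuleCat.{u} k[G]) [Projective M] :
    HasUnitTrace k G M :=
  have : Module.Projective k[G] M := (IsProjective.iff_projective _).2 ‹_›
  hasUnitTrace_of_projective

lemma HasUnitTrace.injective {M : ModuleCat.{u} k[G]} (h : HasUnitTrace k G M) : Injective M where
  factors {X Y} f i hi := by
    obtain ⟨e, he⟩ := h.exists_extension i.hom ((ModuleCat.mono_iff_injective i).1 hi) f.hom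
    exact ⟨ModuleCat.ofHom e, by ext x; exact he x⟩

/-- Over the group algebra of a finite group over a field, projective modules are injective. -/
lemma injective_of_projective (M : ModuleCat.{u} k[G]) [Projective M] : Injective M :=
  (hasUnitTrace_of_projective_moduleCat M).injective

/-- Over the group algebra of a finite group over a field, an injective module is projective, as
it is a direct summand of the free module which contains it by `toInduced`. -/
lemma projective_of_injective (M : ModuleCat.{u} k[G]) [Injective M] : Projective M := by
  let i : M ⟶ ModuleCat.of k[G] (k[G] ⊗[k] M) := ModuleCat.ofHom (toInduced k G M)
  have : Mono i := (ModuleCat.mono_iff_injective i).2 toInduced_injective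
  have : Projective (ModuleCat.of k[G] (k[G] ⊗[k] M)) :=
    ModuleCat.projective_of_free ((Module.Free.chooseBasis k M).baseChange k[G])
  exact (Retract.mk i (Injective.factorThru (𝟙 M) i) (Injective.comp_factorThru _ _)).projective

end ModuleCat

end

/-! ### Complete projective resolutions and the right adjoint -/

section

open Limits CochainComplex HomComplex
open scoped MonoidAlgebra

section

variable (k : Type*) [Ring k] {A : Type u} [Ring A] [Linear k (ModuleCat.{u} A)]

lemma acyclic_homComplex {X : CochainComplex (ModuleCat.{u} A) ℤ} (hX : X.Acyclic)
    (Q : ModuleCat.{u} A) [Injective Q] : (homComplex k X Q).Acyclic := by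
  intro i
  rw [HomologicalComplex.exactAt_iff' _ (i + 1) i (i - 1)
    (ComplexShape.prev_eq' _ (show i + 1 = i + 1 from rfl))
    (ComplexShape.next_eq' _ (show i - 1 + 1 = i by simp)),
    ShortComplex.moduleCat_exact_iff]
  intro (f : X.X i ⟶ Q) (hf : X.d (i - 1) i ≫ f = 0)
  have h := (X.exactAt_iff' (i - 1) i (i + 1) (by simp) (by simp)).1 (hX i)
  exact ⟨h.descToInjective f hf, h.comp_descToInjective f hf⟩

/-- The map `Hom_A(Y, N) ⟶ Hom_A(X, N)` defined by `f : X ⟶ Y`. -/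
def homComplexMap {X Y : CochainComplex (ModuleCat.{u} A) ℤ} (f : X ⟶ Y) (N : ModuleCat.{u} A) :
    homComplex k Y N ⟶ homComplex k X N :=
  (((linearYoneda k (ModuleCat.{u} A)).obj N).mapHomologicalComplex _).map
    ((HomologicalComplex.opFunctor _ _).map f.op)

/-- The functor `Hom_A(-, N)` preserves homotopy equivalences. -/
def homComplexHomotopyEquiv {X Y : CochainComplex (ModuleCat.{u} A) ℤ} (e : HomotopyEquiv X Y)
    (N : ModuleCat.{u} A) : HomotopyEquiv (homComplex k Y N) (homComplex k X N) where
  hom := homComplexMap k e.hom N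
  inv := homComplexMap k e.inv N
  homotopyHomInvId := (Homotopy.ofEq (by simp [homComplexMap]; rfl)).trans
    ((((linearYoneda k (ModuleCat.{u} A)).obj N).mapHomotopy e.homotopyInvHomId.op).trans
      (Homotopy.ofEq (by simp; rfl)))
  homotopyInvHomId := (Homotopy.ofEq (by simp [homComplexMap]; rfl)).trans
    ((((linearYoneda k (ModuleCat.{u} A)).obj N).mapHomotopy e.homotopyHomInvId.op).trans
      (Homotopy.ofEq (by simp; rfl)))

/-- Homotopy equivalent complexes have isomorphic cohomology with coefficients in `N`. -/
def homCohomologyIso {X Y : CochainComplex (ModuleCat.{u} A) ℤ} (e : HomotopyEquiv X Y)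
    (N : ModuleCat.{u} A) (i : ℤ) : homCohomology k X N i ≅ homCohomology k Y N i :=
  ((homComplexHomotopyEquiv k e N).toHomologyIso (-i)).symm

end

section

variable {k G : Type u} [Field k] [Group G] [Fintype G]

/-- An acyclic complex of projective modules over the group algebra is a complete projective
resolution, because the projective modules in the second argument of `Hom` are injective. -/
def completeResolution (T : CochainComplex (ModuleCat.{u} k[G]) ℤ) (hT : T.Acyclic)
    (hp : ∀ i, Projective (T.X i)) : TateExt.E k[G] where
  obj := ⟨(HomotopyCategory.quotient _ _).obj T, hp⟩
  property := ⟨hT, fun Q _ =>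
    have : Injective Q := injective_of_projective Q
    acyclic_homComplex ℤ hT Q⟩

/-- A couniversal map from an acyclic complex of projective modules, as an object of the comma
category of the inclusion over `X`. -/
def IsAcyclicCoreflection.costructuredArrow {X : KProj k[G]}
    {T : CochainComplex (ModuleCat.{u} k[G]) ℤ}
    {p : T ⟶ X.complex} (h : IsAcyclicCoreflection p) (hp : ∀ i, Projective (T.X i)) :
    CostructuredArrow (inclusion k[G]) X :=
  CostructuredArrow.mk (Y := completeResolution T h.acyclic hp)
    (ObjectProperty.homMk ((HomotopyCategory.quotient _ _).map p))

/-- A couniversal map from an acyclic complex of projective modules is a terminal object of the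
comma category, hence computes the value at `X` of a right adjoint of the inclusion. -/
def IsAcyclicCoreflection.isTerminal {X : KProj k[G]}
    {T : CochainComplex (ModuleCat.{u} k[G]) ℤ}
    {p : T ⟶ X.complex} (h : IsAcyclicCoreflection p) (hp : ∀ i, Projective (T.X i)) :
    IsTerminal (h.costructuredArrow hp) := by
  have hex : ∀ B : CostructuredArrow (inclusion k[G]) X, Nonempty (B ⟶ h.costructuredArrow hp) := by
    intro B
    obtain ⟨g, hg⟩ := (HomotopyCategory.quotient _ _).map_surjective
      (X := B.left.obj.complex) (Y := X.complex) B.hom.hom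
    obtain ⟨g', hg'⟩ := h.exists_lift B.left.property.1 g
    refine ⟨CostructuredArrow.homMk (ObjectProperty.homMk (ObjectProperty.homMk
      ((HomotopyCategory.quotient _ _).map g'))) ?_⟩
    apply ObjectProperty.hom_ext
    refine Eq.trans ?_ hg
    rw [← hg']
    exact ((HomotopyCategory.quotient _ _).map_comp g' p).symm
  have huniq : ∀ (B : CostructuredArrow (inclusion k[G]) X) (a b : B ⟶ h.costructuredArrow hp),
      a = b := by
    intro B a b
    apply CostructuredArrow.hom_ext
    apply ObjectProperty.hom_ext
    apply ObjectProperty.hom_ext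
    obtain ⟨u, hu⟩ := (HomotopyCategory.quotient _ _).map_surjective
      (X := B.left.obj.complex) (Y := T) a.left.hom.hom
    obtain ⟨v, hv⟩ := (HomotopyCategory.quotient _ _).map_surjective
      (X := B.left.obj.complex) (Y := T) b.left.hom.hom
    have hw : (HomotopyCategory.quotient _ _).map (u ≫ p) =
        (HomotopyCategory.quotient _ _).map (v ≫ p) := by
      rw [Functor.map_comp, Functor.map_comp, hu, hv]
      exact congrArg (fun f => f.hom) ((CostructuredArrow.w a).trans (CostructuredArrow.w b).symm)
    have hw' : (HomotopyCategory.quotient _ _).map ((u - v) ≫ p) = 0 := by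
      rw [Preadditive.sub_comp, Functor.map_sub, hw, sub_self]
    rw [HomotopyCategory.quotient_map_eq_zero_iff] at hw'
    have h0 := (HomotopyCategory.quotient_map_eq_zero_iff _).2
      (h.homotopy_lift B.left.property.1 (u - v) hw')
    rw [Functor.map_sub, sub_eq_zero, hu, hv] at h0
    exact h0
  exact IsTerminal.ofUniqueHom (fun B => (hex B).some) fun B m => huniq B _ _

/-- The inclusion of the complete projective resolutions over the group algebra of a finite group
has a right adjoint. Its value at `X` is the limit of the tower of coinduced complexes over `X`,
whose terms are injective, hence projective. -/
theorem isLeftAdjoint_inclusion : (inclusion k[G]).IsLeftAdjoint := by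
  rw [isLeftAdjoint_iff_hasTerminal_costructuredArrow]
  intro X
  have (i : ℤ) : Injective (X.complex.X i) :=
    have := X.property i
    injective_of_projective _
  exact ((isAcyclicCoreflection_acyclicCoverπ (algebraMap k k[G]) X.complex).isTerminal fun i =>
    have := injective_acyclicCover (algebraMap k k[G]) X.complex i
    projective_of_injective _).hasTerminal

/-- The cohomology of the value of any right adjoint at `X` can be computed with any couniversal
map to `X` from an acyclic complex of projective modules. -/
lemma nonempty_homCohomology_iso {eShriek : KProj k[G] ⥤ TateExt.E k[G]}
    (adj : inclusion k[G] ⊣ eShriek) {X : KProj k[G]} {T : CochainComplex (ModuleCat.{u} k[G]) ℤ}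
    {p : T ⟶ X.complex} (h : IsAcyclicCoreflection p) (hp : ∀ i, Projective (T.X i))
    (N : ModuleCat.{u} k[G]) (i : ℤ) :
    Nonempty (homCohomology k (eShriek.obj X).obj.complex N i ≅ homCohomology k T N i) := by
  let e := (mkTerminalOfRightAdjoint _ adj X).uniqueUpToIso (h.isTerminal hp)
  let e' := ((isCompleteResolution k[G]).ι ⋙ (isComplexOfProjectives k[G]).ι).mapIso
    ((CostructuredArrow.proj _ _).mapIso e)
  exact ⟨homCohomologyIso k (HomotopyCategory.homotopyEquivOfIso e') N i⟩

end

end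

/-! ### Vanishing of Tate cohomology on projective representations -/

section

open Limits
open scoped MonoidAlgebra

variable {k G : Type u} [Field k] [Group G] [Fintype G]

omit [Fintype G] in
/-- A projective representation is a direct summand of a representation induced from the trivial
subgroup, whose homology is given by Shapiro's lemma. -/
lemma isZero_groupHomology_succ_of_projective (F : Rep.{u} k G) [Projective F] (n : ℕ) :
    IsZero (groupHomology F (n + 1)) := by
  classical
  let adj := Rep.indResAdjunction k (⊥ : Subgroup G).subtype
  let ε : Rep.ind (⊥ : Subgroup G).subtype (Rep.res (⊥ : Subgroup G).subtype F) ⟶ F :=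
    adj.counit.app F
  have : Epi ε := inferInstanceAs (Epi (adj.counit.app F))
  let s := Projective.factorThru (𝟙 F) ε
  have hs : s ≫ ε = 𝟙 F := Projective.factorThru_comp _ _
  let r := (Retract.mk s ε hs).map (groupHomology.functor k G (n + 1))
  have h0 : IsZero (groupHomology
      (Rep.ind (⊥ : Subgroup G).subtype (Rep.res (⊥ : Subgroup G).subtype F)) (n + 1)) :=
    (isZero_groupHomology_succ_of_subsingleton _ n).of_iso (groupHomology.indIso _ _ _)
  refine (IsZero.iff_id_eq_zero _).2 ?_
  exact r.retract.symm.trans ((congrArg (· ≫ r.r) (h0.eq_of_tgt r.i 0)).trans zero_comp)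

omit [Fintype G] in
/-- The bar resolution stays exact in positive degrees when maps into an injective representation
are taken. -/
lemma isZero_groupCohomology_succ_of_injective (F : Rep.{u} k G) [Injective F] (n : ℕ) :
    IsZero (groupCohomology F (n + 1)) := by
  let P := Rep.barResolution k G
  refine IsZero.of_iso ?_ (groupCohomologyIso F (n + 1) P)
  rw [← HomologicalComplex.exactAt_iff_isZero_homology,
    HomologicalComplex.exactAt_iff' _ n (n + 1) (n + 2) (by simp) (by simp),
    ShortComplex.moduleCat_exact_iff]
  intro (f : P.complex.X (n + 1) ⟶ F) (hf : P.complex.d (n + 2) (n + 1) ≫ f = 0)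
  have h := (P.complex.exactAt_iff' (n + 2) (n + 1) n (by simp) (by simp)).1
    (P.complex_exactAt_succ n)
  exact ⟨h.descToInjective f hf, h.comp_descToInjective f hf⟩

/-- Higman's criterion for representations. -/
lemma exists_unitTrace (F : Rep.{u} k G) [Projective F] :
    ∃ θ : F →ₗ[k] F, ∀ x, ∑ g : G, F.ρ g⁻¹ (θ (F.ρ g x)) = x := by
  have h : Projective (Rep.toModuleMonoidAlgebra.obj F) :=
    (Rep.equivalenceModuleMonoidAlgebra.map_projective_iff F).2 inferInstance
  have : Module.Projective k[G] F.ρ.asModule := (IsProjective.iff_projective _).2 h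
  obtain ⟨θ, hθ⟩ := hasUnitTrace_of_projective (k := k) (G := G) (M := F.ρ.asModule)
  have h₁ (g : G) (v : F.ρ.asModule) : MonoidAlgebra.single g (1 : k) • v = F.ρ g v := by
    rw [Representation.single_smul, one_smul]
    rfl
  refine ⟨θ, fun x => (Finset.sum_congr rfl fun g _ => ?_).trans (hθ x)⟩
  exact ((LinearMap.conjugate_apply θ g _).trans
    ((h₁ g⁻¹ _).trans (congrArg (fun y => F.ρ g⁻¹ (θ y)) (h₁ g x)))).symm

/-- The part of the Tate complex around degree zero, with the norm as its first map. -/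
def tateShortComplexZero (M : Rep.{u} k G) : ShortComplex (ModuleCat.{u} k) :=
  ShortComplex.mk M.norm.toModuleCatHom (groupCohomology.d₀₁ M) M.norm_comp_d_eq_zero

/-- The part of the Tate complex around degree zero, expressed by low-degree cochains. -/
def tateComplexScZeroIso (M : Rep.{u} k G) :
    (tateComplex M).sc' (-1) 0 1 ≅ tateShortComplexZero M :=
  ShortComplex.isoMk (groupHomology.chainsIso₀ M) (groupCohomology.cochainsIso₀ M)
    (groupCohomology.cochainsIso₁ M)
    (by
      change _ = M.tateNorm ≫ _
      simp [Rep.tateNorm, tateShortComplexZero]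
      rfl)
    (groupCohomology.comp_d₀₁_eq M)

/-- The part of the Tate complex around degree `-1`, with the norm as its second map. -/
def tateShortComplexNegOne (M : Rep.{u} k G) : ShortComplex (ModuleCat.{u} k) :=
  ShortComplex.mk (groupHomology.d₁₀ M) M.norm.toModuleCatHom M.comp_eq_zero

/-- The part of the Tate complex around degree `-1`, expressed by low-degree chains. -/
def tateComplexScNegOneIso (M : Rep.{u} k G) :
    (tateComplex M).sc' (-2) (-1) 0 ≅ tateShortComplexNegOne M :=
  ShortComplex.isoMk (groupHomology.chainsIso₁ M) (groupHomology.chainsIso₀ M)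
    (groupCohomology.cochainsIso₀ M)
    (groupHomology.comp_d₁₀_eq M)
    (by
      change _ = M.tateNorm ≫ _
      simp [Rep.tateNorm, tateShortComplexNegOne]
      rfl)

lemma norm_toModuleCatHom_apply (M : Rep.{u} k G) (x : M) :
    M.norm.toModuleCatHom.hom x = ∑ g : G, M.ρ g x := by
  change M.ρ.norm x = _
  simp [Representation.norm, LinearMap.sum_apply]

omit [Fintype G] in
lemma d₀₁_eq_zero_iff (M : Rep.{u} k G) (x : M) :
    groupCohomology.d₀₁ M x = 0 ↔ ∀ g, M.ρ g x = x := by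
  refine funext_iff.trans (forall_congr' fun g => ?_)
  rw [groupCohomology.d₀₁_hom_apply, Pi.zero_apply, sub_eq_zero]

lemma exact_tateShortComplexZero (F : Rep.{u} k G) [Projective F] :
    (tateShortComplexZero F).Exact := by
  obtain ⟨θ, hθ⟩ := exists_unitTrace F
  rw [ShortComplex.moduleCat_exact_iff]
  intro (x : F) (hx : groupCohomology.d₀₁ F x = 0)
  have hx' := (d₀₁_eq_zero_iff F x).1 hx
  refine ⟨(θ x : F), (norm_toModuleCatHom_apply F _).trans ?_⟩
  conv_rhs => rw [← hθ x]
  exact Fintype.sum_equiv (Equiv.inv G) _ _ fun g => by simp [hx']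

lemma exact_tateShortComplexNegOne (F : Rep.{u} k G) [Projective F] :
    (tateShortComplexNegOne F).Exact := by
  obtain ⟨θ, hθ⟩ := exists_unitTrace F
  rw [ShortComplex.moduleCat_exact_iff]
  intro (x : F) (hx : F.norm.toModuleCatHom.hom x = 0)
  rw [norm_toModuleCatHom_apply] at hx
  refine ⟨(∑ g : G, Finsupp.single g (θ (F.ρ g x)) : G →₀ F), ?_⟩
  change groupHomology.d₁₀ F (∑ g : G, Finsupp.single g (θ (F.ρ g x)) : G →₀ F) = x
  rw [map_sum]
  refine (Finset.sum_congr rfl fun g _ => groupHomology.d₁₀_single F g (θ (F.ρ g x))).trans ?_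
  rw [Finset.sum_sub_distrib, hθ, ← map_sum, hx, map_zero, sub_zero]

/-- The Tate cohomology of a representation which is projective and injective vanishes in all
degrees. -/
theorem acyclic_tateComplex (F : Rep.{u} k G) [Projective F] [Injective F] :
    (tateComplex F).Acyclic := by
  intro i
  obtain (n | rfl | rfl | n) : (∃ n : ℕ, i = (n + 1 : ℕ)) ∨ i = 0 ∨ i = -1 ∨
      (∃ n : ℕ, i = -((n + 1 : ℕ) + 1)) := by
    obtain h | h | h | h : 1 ≤ i ∨ i = 0 ∨ i = -1 ∨ i ≤ -2 := by lia
    · exact Or.inl ⟨(i - 1).toNat, by lia⟩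
    · exact Or.inr (Or.inl h)
    · exact Or.inr (Or.inr (Or.inl h))
    · exact Or.inr (Or.inr (Or.inr ⟨(-i - 2).toNat, by lia⟩))
  · obtain ⟨n, rfl⟩ := n
    rw [HomologicalComplex.exactAt_iff_isZero_homology]
    exact (isZero_groupCohomology_succ_of_injective F n).of_iso
      ((TateCohomology.isoGroupCohomology (n + 1)).app F)
  · rw [HomologicalComplex.exactAt_iff' _ (-1) 0 1 (by simp) (by simp)]
    exact ShortComplex.exact_of_iso (tateComplexScZeroIso F).symm (exact_tateShortComplexZero F)
  · rw [HomologicalComplex.exactAt_iff' _ (-2) (-1) 0 (by simp) (by simp)]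
    exact ShortComplex.exact_of_iso (tateComplexScNegOneIso F).symm (exact_tateShortComplexNegOne F)
  · obtain ⟨n, rfl⟩ := n
    rw [HomologicalComplex.exactAt_iff_isZero_homology]
    exact (isZero_groupHomology_succ_of_projective F n).of_iso
      ((TateCohomology.isoGroupHomology _ (n + 1) rfl).app F)

end

/-! ### Dimension shifting -/

section

open Limits
open scoped MonoidAlgebra

section

variable (k : Type*) [Ring k] {A : Type u} [Ring A] [Linear k (ModuleCat.{u} A)]
  (X : CochainComplex (ModuleCat.{u} A) ℤ)

/-- The short complex of complexes `Hom_A(X, S)`, for a short complex `S` of modules. -/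
def homShortComplex (S : ShortComplex (ModuleCat.{u} A)) :
    ShortComplex (HomologicalComplex (ModuleCat k) (ComplexShape.up ℤ).symm) :=
  ShortComplex.mk (X₁ := homComplex k X S.X₁) (X₂ := homComplex k X S.X₂)
    (X₃ := homComplex k X S.X₃)
    ((NatTrans.mapHomologicalComplex ((linearYoneda k (ModuleCat.{u} A)).map S.f) _).app X.op)
    ((NatTrans.mapHomologicalComplex ((linearYoneda k (ModuleCat.{u} A)).map S.g) _).app X.op)
    (by
      ext i (x : X.X i ⟶ S.X₁)
      exact (Category.assoc _ _ _).trans ((congrArg (x ≫ ·) S.zero).trans comp_zero))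

variable {X}

lemma shortExact_homShortComplex (hX : ∀ i, Projective (X.X i))
    {S : ShortComplex (ModuleCat.{u} A)} (hS : S.ShortExact) :
    (homShortComplex k X S).ShortExact := by
  refine HomologicalComplex.shortExact_of_degreewise_shortExact _ fun i => ?_
  have := hX i
  have := hS.mono_f
  have := hS.epi_g
  refine ShortComplex.ShortExact.mk' ?_ ?_ ?_
  · rw [ShortComplex.moduleCat_exact_iff]
    intro (f : X.X i ⟶ S.X₂) (hf : f ≫ S.g = 0)
    exact ⟨hS.exact.lift f hf, hS.exact.lift_f f hf⟩
  · rw [ModuleCat.mono_iff_injective]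
    intro (f : X.X i ⟶ S.X₁) (g : X.X i ⟶ S.X₁) (h : f ≫ S.f = g ≫ S.f)
    exact (cancel_mono _).1 h
  · rw [ModuleCat.epi_iff_surjective]
    intro (f : X.X i ⟶ S.X₃)
    exact (hX i).factors f S.g

lemma nonempty_homCohomology_shift (hX : ∀ i, Projective (X.X i)) (hac : X.Acyclic)
    {S : ShortComplex (ModuleCat.{u} A)} (hS : S.ShortExact) [Injective S.X₂] (i : ℤ) :
    Nonempty (homCohomology k X S.X₃ i ≅ homCohomology k X S.X₁ (i + 1)) :=
  ⟨(shortExact_homShortComplex k hX hS).δIso (-i) (-(i + 1))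
    (show -(i + 1) + 1 = -i by lia)
    ((HomologicalComplex.exactAt_iff_isZero_homology _ _).1 (acyclic_homComplex k hac S.X₂ _))
    ((HomologicalComplex.exactAt_iff_isZero_homology _ _).1 (acyclic_homComplex k hac S.X₂ _))⟩

end

section

variable {k G : Type u} [Field k] [Group G] [Fintype G]

lemma nonempty_tateCohomology_shift {S : ShortComplex (Rep.{u} k G)} (hS : S.ShortExact)
    [Projective S.X₂] [Injective S.X₂] (i : ℤ) :
    Nonempty (tateCohomology S.X₃ i ≅ tateCohomology S.X₁ (i + 1)) :=
  ⟨(TateCohomology.map_tateComplexFunctor_shortExact hS).δIso i (i + 1) rfl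
    ((HomologicalComplex.exactAt_iff_isZero_homology _ _).1 (acyclic_tateComplex S.X₂ _))
    ((HomologicalComplex.exactAt_iff_isZero_homology _ _).1 (acyclic_tateComplex S.X₂ _))⟩

lemma nonempty_tateCohomology_ofModule_shift {S : ShortComplex (ModuleCat.{u} k[G])}
    (hS : S.ShortExact) [Projective S.X₂] [Injective S.X₂] (i : ℤ) :
    Nonempty (tateCohomology (Rep.ofModuleMonoidAlgebra.obj S.X₃) i ≅
      tateCohomology (Rep.ofModuleMonoidAlgebra.obj S.X₁) (i + 1)) := by
  let F : ModuleCat.{u} k[G] ≌ Rep.{u} k G :=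
    (Rep.equivalenceModuleMonoidAlgebra (k := k) (G := G)).symm
  have hS' : (S.map F.functor).ShortExact := hS.map_of_exact F.functor
  have : Projective (S.map F.functor).X₂ := (F.map_projective_iff S.X₂).2 inferInstance
  have : Injective (S.map F.functor).X₂ := (F.map_injective_iff S.X₂).2 inferInstance
  exact nonempty_tateCohomology_shift hS' i

/-- Dimension shifting: for an acyclic complex `T` of projective modules, the cohomology of
`Hom(T, M)` agrees with Tate cohomology in all degrees if it does so in degree zero for all
modules. Both shift degrees along short exact sequences with a projective (equivalently,
injective) middle term, and `M` is the first term of one such sequence and the last term of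
another. -/
lemma nonempty_homCohomology_iso_tateCohomology_of_zero {T : CochainComplex (ModuleCat.{u} k[G]) ℤ}
    (hT : ∀ i, Projective (T.X i)) (hac : T.Acyclic)
    (h₀ : ∀ M : ModuleCat.{u} k[G],
      Nonempty (homCohomology k T M 0 ≅ tateCohomology (Rep.ofModuleMonoidAlgebra.obj M) 0))
    (i : ℤ) (M : ModuleCat.{u} k[G]) :
    Nonempty (homCohomology k T M i ≅ tateCohomology (Rep.ofModuleMonoidAlgebra.obj M) i) := by
  induction i using Int.induction_on generalizing M with
  | zero => exact h₀ M
  | succ i ih =>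
    let S : ShortComplex (ModuleCat.{u} k[G]) := ShortComplex.mk (Injective.ι M)
      (cokernel.π (Injective.ι M)) (cokernel.condition _)
    have hS : S.ShortExact := ShortComplex.ShortExact.mk'
      (ShortComplex.exact_of_g_is_cokernel _ (cokernelIsCokernel _))
      (inferInstanceAs (Mono (Injective.ι M)))
      (inferInstanceAs (Epi (cokernel.π (Injective.ι M))))
    have : Injective S.X₂ := inferInstanceAs (Injective (Injective.under M))
    have := projective_of_injective S.X₂
    obtain ⟨a⟩ := nonempty_homCohomology_shift k hT hac hS i
    obtain ⟨b⟩ := nonempty_tateCohomology_ofModule_shift hS i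
    obtain ⟨c⟩ := ih S.X₃
    exact ⟨a.symm ≪≫ c ≪≫ b⟩
  | pred i ih =>
    let S : ShortComplex (ModuleCat.{u} k[G]) := ShortComplex.mk (kernel.ι (Projective.π M))
      (Projective.π M) (kernel.condition _)
    have hS : S.ShortExact := ShortComplex.ShortExact.mk'
      (ShortComplex.exact_of_f_is_kernel _ (kernelIsKernel _))
      (inferInstanceAs (Mono (kernel.ι (Projective.π M))))
      (inferInstanceAs (Epi (Projective.π M)))
    have : Projective S.X₂ := inferInstanceAs (Projective (Projective.over M))
    have := injective_of_projective S.X₂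
    obtain ⟨a⟩ := nonempty_homCohomology_shift k hT hac hS (-i - 1)
    obtain ⟨b⟩ := nonempty_tateCohomology_ofModule_shift hS (-i - 1)
    rw [sub_add_cancel] at a b
    obtain ⟨c⟩ := ih S.X₁
    exact ⟨a ≪≫ c ≪≫ b.symm⟩

end

end

/-! ### Comparison in degree zero -/

section

open Limits
open scoped MonoidAlgebra

/-- An isomorphism between the homologies of two short complexes, from a linear map between the
middle terms which is compatible with cycles and boundaries and surjective on cycles. It need not
extend to a morphism of short complexes. -/
lemma nonempty_homology_iso_of_linearMap {R : Type*} [Ring R]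
    {S₁ S₂ : ShortComplex (ModuleCat.{u} R)}
    (e : S₁.X₂ →ₗ[R] S₂.X₂) (h₁ : ∀ f, S₁.g f = 0 → S₂.g (e f) = 0)
    (h₂ : ∀ v, S₂.g v = 0 → ∃ f, S₁.g f = 0 ∧ e f = v)
    (h₃ : ∀ f, S₁.g f = 0 → ((∃ a, S₁.f a = f) ↔ ∃ b, S₂.f b = e f)) :
    Nonempty (S₁.homology ≅ S₂.homology) := by
  let e' : LinearMap.ker S₁.g.hom →ₗ[R]
      LinearMap.ker S₂.g.hom ⧸ LinearMap.range S₂.moduleCatToCycles :=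
    (LinearMap.range S₂.moduleCatToCycles).mkQ ∘ₗ e.restrict (p := LinearMap.ker S₁.g.hom) h₁
  have he : Function.Surjective e' := by
    refine (Submodule.mkQ_surjective _).comp fun ⟨v, hv⟩ => ?_
    obtain ⟨f, hf, rfl⟩ := h₂ v hv
    exact ⟨⟨f, hf⟩, rfl⟩
  have hker : LinearMap.range S₁.moduleCatToCycles = LinearMap.ker e' := by
    ext ⟨f, hf⟩
    rw [LinearMap.mem_ker, LinearMap.comp_apply, Submodule.mkQ_apply, Submodule.Quotient.mk_eq_zero,
      LinearMap.mem_range, LinearMap.mem_range]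
    refine Iff.trans ?_ ((h₃ f hf).trans ?_)
    · exact exists_congr fun a => Subtype.ext_iff
    · exact exists_congr fun a =>
        ⟨fun h => Subtype.ext h, fun h => congrArg Subtype.val h⟩
  exact ⟨S₁.moduleCatHomologyIso ≪≫ ((Submodule.quotEquivOfEq _ _ hker).trans
    (e'.quotKerEquivOfSurjective he)).toModuleIso ≪≫ S₂.moduleCatHomologyIso.symm⟩

section

variable {k G : Type*} [Field k] [Group G]
  {P Q M : Type*} [AddCommGroup P] [Module k P] [Module k[G] P] [IsScalarTower k k[G] P]
  [AddCommGroup Q] [Module k Q] [Module k[G] Q] [IsScalarTower k k[G] Q]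
  [AddCommGroup M] [Module k M] [Module k[G] M] [IsScalarTower k k[G] M]

/-- If the image of `d` lies in the line spanned by a nonzero invariant vector `x`, the coordinate
of `d t` with respect to `x` is an invariant linear functional of `t`. -/
lemma exists_invariant_functional (d : P →ₗ[k[G]] Q) {x : Q} (hx : x ≠ 0)
    (hg : ∀ g : G, MonoidAlgebra.single g (1 : k) • x = x) (hd : ∀ t, ∃ c : k, d t = c • x) :
    ∃ l : P →ₗ[k] k, (∀ t, d t = l t • x) ∧
      ∀ (g : G) t, l (MonoidAlgebra.single g (1 : k) • t) = l t := by
  obtain ⟨r, hr⟩ := (LinearMap.toSpanSingleton k Q x).exists_leftInverse_of_injective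
    (LinearMap.ker_toSpanSingleton k hx)
  have hr' : r x = 1 := by simpa using LinearMap.congr_fun hr 1
  have h (t : P) : d t = r (d t) • x := by
    obtain ⟨c, hc⟩ := hd t
    rw [hc, map_smul, hr', smul_eq_mul, mul_one]
  refine ⟨r ∘ₗ d.restrictScalars k, h, fun g t => ?_⟩
  change r (d _) = r (d t)
  rw [map_smul, h t, smul_comm, hg]

/-- The equivariant map `t ↦ l t • v`, for an invariant functional `l` and an invariant vector
`v`. -/
def smulRightOfInvariant (l : P →ₗ[k] k)
    (hl : ∀ (g : G) t, l (MonoidAlgebra.single g (1 : k) • t) = l t)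
    (v : M) (hv : ∀ g : G, MonoidAlgebra.single g (1 : k) • v = v) : P →ₗ[k[G]] M :=
  MonoidAlgebra.equivariantOfLinearOfComm (l.smulRight v) fun g t => by
    rw [LinearMap.smulRight_apply, LinearMap.smulRight_apply, hl, smul_comm, hv]

end

section

open scoped ModuleCat
variable {k G : Type u} [Field k] [Group G] [Fintype G]

lemma sum_single_smul_eq (M : Type*) [AddCommGroup M] [Module k[G] M] (h : G) (m : M) :
    MonoidAlgebra.single h (1 : k) • ∑ g : G, MonoidAlgebra.single g (1 : k) • m =
      ∑ g : G, MonoidAlgebra.single g (1 : k) • m := by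
  rw [Finset.smul_sum]
  exact Fintype.sum_equiv (Equiv.mulLeft h) _ _ fun g => by
    simp [smul_smul, MonoidAlgebra.single_mul_single]

/-- Let `T` be an acyclic complex of projective modules whose cocycles in degree one form the
trivial module, generated by `x`. Evaluation at a preimage `y` of `x` identifies the cocycles in
`Hom(T⁰, M)` with the invariants of `M`, and the coboundaries, which are the maps that factor
through the differential `T⁰ ⟶ T¹`, with the norms. -/
lemma nonempty_homCohomology_zero_iso {T : CochainComplex (ModuleCat.{u} k[G]) ℤ}
    (hT : ∀ i, Projective (T.X i)) (hac : T.Acyclic) (x : T.X 1) (hx : x ≠ 0)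
    (hg : ∀ g : G, MonoidAlgebra.single g (1 : k) • x = x)
    (hd : (T.d 1 2).hom x = 0)
    (hz : ∀ z : T.X 1, (T.d 1 2).hom z = 0 → ∃ c : k, z = c • x) (M : ModuleCat.{u} k[G]) :
    Nonempty (homCohomology k T M 0 ≅ tateCohomology (Rep.ofModuleMonoidAlgebra.obj M) 0) := by
  have hex₀ := (T.exactAt_iff' (-1) 0 1 (by simp) (by simp)).1 (hac 0)
  have hex₁ := (T.exactAt_iff' 0 1 2 (by simp) (by simp)).1 (hac 1)
  have hex₀' (t : T.X 0) (ht : (T.d 0 1).hom t = 0) : ∃ w, (T.d (-1) 0).hom w = t :=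
    (ShortComplex.moduleCat_exact_iff _).1 hex₀ t ht
  have hdd (w : T.X (-1)) : (T.d 0 1).hom ((T.d (-1) 0).hom w) = 0 :=
    ConcreteCategory.congr_hom (T.d_comp_d (-1) 0 1) w
  have hdd' (w : T.X 0) : (T.d 1 2).hom ((T.d 0 1).hom w) = 0 :=
    ConcreteCategory.congr_hom (T.d_comp_d 0 1 2) w
  obtain ⟨y, hy⟩ : ∃ y, (T.d 0 1).hom y = x := (ShortComplex.moduleCat_exact_iff _).1 hex₁ x hd
  obtain ⟨l, hl, hlg⟩ := exists_invariant_functional (T.d 0 1).hom hx hg fun t => hz _ (hdd' t)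
  have hly : l y = 1 := by
    have := hl y
    rw [hy] at this
    exact (smul_left_injective k hx ((one_smul k x).trans this)).symm
  have hld (w : T.X (-1)) : l ((T.d (-1) 0).hom w) = 0 :=
    (smul_eq_zero.1 ((hl _).symm.trans (hdd w))).resolve_right hx
  -- a cocycle is determined by its value at `y`
  have hf (f : T.X 0 ⟶ M) (hf : T.d (-1) 0 ≫ f = 0) (t : T.X 0) : f.hom t = l t • f.hom y := by
    obtain ⟨w, hw⟩ := hex₀' (t - l t • y) (by
      rw [map_sub, LinearMap.map_smul_of_tower, hy, hl t, sub_self])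
    have := ConcreteCategory.congr_hom hf w
    rw [← LinearMap.map_smul_of_tower, ← sub_eq_zero, ← map_sub, ← hw]
    exact this
  let e : (T.X 0 ⟶ M) →ₗ[k] Rep.ofModuleMonoidAlgebra.obj M :=
    { toFun f := f.hom y
      map_add' _ _ := rfl
      map_smul' _ _ := rfl }
  change Nonempty ((homComplex k T M).homology (-0) ≅ _)
  rw [neg_zero]
  suffices Nonempty (((homComplex k T M).sc' 1 0 (-1)).homology ≅
      (tateShortComplexZero (Rep.ofModuleMonoidAlgebra.obj M)).homology) by
    obtain ⟨a⟩ := this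
    refine ⟨ShortComplex.homologyMapIso ((homComplex k T M).isoSc' 1 0 (-1)
      (ComplexShape.prev_eq' _ (show (0 : ℤ) + 1 = 1 from rfl))
      (ComplexShape.next_eq' _ (show (-1 : ℤ) + 1 = 0 by simp))) ≪≫ a ≪≫
      (ShortComplex.homologyMapIso ((tateComplex _).isoSc' (-1) 0 1 (by simp) (by simp) ≪≫
        tateComplexScZeroIso (Rep.ofModuleMonoidAlgebra.obj M))).symm⟩
  have hinv (v : M) : groupCohomology.d₀₁ (Rep.ofModuleMonoidAlgebra.obj M) v = 0 ↔
      ∀ g : G, MonoidAlgebra.single g (1 : k) • v = v := d₀₁_eq_zero_iff _ _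
  have hnorm (v : M) : (Rep.ofModuleMonoidAlgebra.obj M).norm.toModuleCatHom.hom v =
      ∑ g : G, MonoidAlgebra.single g (1 : k) • v := norm_toModuleCatHom_apply _ _
  refine nonempty_homology_iso_of_linearMap e ?_ ?_ ?_
  · intro (f : T.X 0 ⟶ M) (hfd : T.d (-1) 0 ≫ f = 0)
    refine (hinv (f.hom y)).2 fun g => ?_
    rw [← map_smul, hf f hfd, hlg, hly, one_smul]
  · intro (v : M) hv
    replace hv := (hinv v).1 hv
    refine ⟨(ModuleCat.ofHom (smulRightOfInvariant l hlg v hv) : T.X 0 ⟶ M), ?_, ?_⟩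
    · change T.d (-1) 0 ≫ _ = 0
      ext w
      change l ((T.d (-1) 0).hom w) • v = 0
      rw [hld, zero_smul]
    · change l y • v = v
      rw [hly, one_smul]
  · intro (f : T.X 0 ⟶ M) (hfd : T.d (-1) 0 ≫ f = 0)
    constructor
    · rintro ⟨(h : T.X 1 ⟶ M), (hh : T.d 0 1 ≫ h = f)⟩
      -- since `T¹` is projective and `x` is invariant, `x = ∑ g, g⁻¹ • θ x` for some linear `θ`
      obtain ⟨θ, hθ⟩ := @hasUnitTrace_of_projective_moduleCat k G _ _ _ (T.X 1) (hT 1)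
      refine ⟨(h.hom (θ x) : M), (hnorm _).trans ?_⟩
      change _ = f.hom y
      rw [← hh, ModuleCat.hom_comp, LinearMap.comp_apply, hy]
      conv_rhs => rw [← hθ x, map_sum]
      exact Fintype.sum_equiv (Equiv.inv G) _ _ fun g => by
        simp [LinearMap.conjugate_apply, hg]
    · rintro ⟨(m : M), hm⟩
      replace hm := (hnorm m).symm.trans hm
      change _ = f.hom y at hm
      -- a cocycle with value the norm of `m` factors through `a ↦ a m` on the
      -- injective module `k[G]`
      let ν : k[G] := ∑ g : G, MonoidAlgebra.single g (1 : k) • (1 : k[G])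
      let f' : T.X 0 ⟶ ModuleCat.of k[G] k[G] :=
        ModuleCat.ofHom (smulRightOfInvariant l hlg ν fun g => sum_single_smul_eq _ g 1)
      let ψ : ModuleCat.of k[G] k[G] ⟶ M := ModuleCat.ofHom (LinearMap.toSpanSingleton k[G] M m)
      have : Projective (ModuleCat.of k[G] k[G]) := (IsProjective.iff_projective _).1 inferInstance
      have := injective_of_projective (ModuleCat.of k[G] k[G])
      have hf' : T.d (-1) 0 ≫ f' = 0 := by
        refine ModuleCat.hom_ext (LinearMap.ext fun w => ?_)
        change l ((T.d (-1) 0).hom w) • ν = 0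
        rw [hld, zero_smul]
      refine ⟨hex₀.descToInjective f' hf' ≫ ψ, ?_⟩
      change T.d 0 1 ≫ _ ≫ _ = f
      have := hex₀.comp_descToInjective f' hf'
      refine (Category.assoc _ _ _).symm.trans ((congrArg (· ≫ ψ) this).trans ?_)
      ext t
      change (l t • ν) • m = f.hom t
      rw [hf f hfd t, smul_assoc, ← hm, Finset.sum_smul]
      simp

end

end

/-! ### The complete resolution of a module -/

section

open Limits CochainComplex HomComplex Pretriangulated
open scoped MonoidAlgebra

section

variable {C : Type*} [Category* C] [Abelian C]

/-- The cocone of a quasi-isomorphism is acyclic, since it is a shift of the cone. -/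
lemma acyclic_mappingCocone {X I : CochainComplex C ℤ} (φ : X ⟶ I) [hφ : QuasiIso φ] :
    (mappingCocone φ).Acyclic := by
  replace hφ : HomologicalComplex.quasiIso C _ φ := hφ
  rw [← HomotopyCategory.quotient_map_mem_quasiIso_iff,
    HomotopyCategory.quasiIso_eq_trW_subcategoryAcyclic] at hφ
  rw [← HomotopyCategory.quotient_obj_mem_subcategoryAcyclic_iff_acyclic]
  have h := ((HomotopyCategory.subcategoryAcyclic C).trW_iff_of_distinguished _
    (HomotopyCategory.mappingCone_triangleh_distinguished φ)).1 hφ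
  exact (HomotopyCategory.subcategoryAcyclic C).prop_of_iso
    (((HomotopyCategory.quotient C (ComplexShape.up ℤ)).commShiftIso (-1 : ℤ)).app
      (mappingCone φ)).symm
    ((HomotopyCategory.subcategoryAcyclic C).le_shift (-1 : ℤ) _ h)

end

/-- If `X` vanishes in positive degrees, the cocycles of degree one in the cocone of `φ : X ⟶ I`
are the cocycles of degree zero in `I`. -/
lemma d_mappingCocone_eq_zero_iff_exists_inr {A : Type u} [Ring A]
    {X I : CochainComplex (ModuleCat.{u} A) ℤ}
    (φ : X ⟶ I) [X.IsStrictlyLE 0] (z : (mappingCocone φ).X 1) :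
    ((mappingCocone φ).d 1 2).hom z = 0 ↔
      ∃ y : I.X 0, (I.d 0 1).hom y = 0 ∧ ((mappingCocone.inr φ).1.v 0 1 (by simp)).hom y = z := by
  constructor
  · intro hz
    refine ⟨((mappingCocone.snd φ).v 1 0 (by simp)).hom z, ?_, ?_⟩
    · have h0 := (X.isZero_of_isStrictlyLE 0 1).eq_of_tgt ((mappingCocone.fst φ).f 1) 0
      have := d_snd_mappingCocone_of_d_eq_zero φ 1 z hz
      rw [h0] at this
      simpa using this
    · have h0 := (X.isZero_of_isStrictlyLE 0 1).eq_of_tgt ((mappingCocone.fst φ).f 1) 0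
      have := mappingCocone.id_X φ 1 0 (by simp)
      rw [h0, zero_comp, zero_add] at this
      exact ConcreteCategory.congr_hom this z
  · rintro ⟨y, hy, rfl⟩
    have h := Cochain.congr_v ((mappingCocone.inr φ).δ_eq_zero 2) 0 2 (by simp)
    rw [δ_v 1 2 (by simp) _ 0 2 (by simp) 1 1 (by simp) (by simp)] at h
    have := ConcreteCategory.congr_hom h y
    simpa [hy] using this

/-- The augmentation of an injective resolution, in the version indexed by the integers,
identifies the module with the cocycles of degree zero. -/
lemma exists_augmentation_injectiveResolution {A : Type u} [Ring A]
    {M : ModuleCat.{u} A} (R : InjectiveResolution M) :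
    ∃ s : M ⟶ R.cochainComplex.X 0, Function.Injective s ∧
     ∀ y, (R.cochainComplex.d 0 1).hom y = 0 ↔ ∃ m, s m = y := by
  have h1 : Mono (R.ι.f 0) := inferInstance
  refine ⟨(show M ⟶ _ from R.ι.f 0) ≫ (R.cochainComplexXIso 0 0 rfl).inv, ?_, ?_⟩
  · rw [← ModuleCat.mono_iff_injective]
    exact mono_comp' h1 inferInstance
  · intro y
    have h2 := (ShortComplex.moduleCat_exact_iff _).1 R.exact₀
    have h3 (m : M) := ConcreteCategory.congr_hom R.ι_f_zero_comp_complex_d m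
    rw [R.cochainComplex_d 0 1 0 1 rfl rfl]
    constructor
    · intro hy
      have hy' : (R.cocomplex.d 0 1).hom ((R.cochainComplexXIso 0 0 rfl).hom.hom y) = 0 :=
        (ModuleCat.mono_iff_injective (R.cochainComplexXIso 1 1 rfl).inv).1 inferInstance
          (hy.trans (map_zero _).symm)
      obtain ⟨m, hm⟩ := h2 _ hy'
      refine ⟨m, ?_⟩
      refine (congrArg (R.cochainComplexXIso 0 0 rfl).inv.hom hm).trans ?_
      exact ConcreteCategory.congr_hom (R.cochainComplexXIso 0 0 rfl).hom_inv_id y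
    · rintro ⟨m, rfl⟩
      have := ConcreteCategory.congr_hom (R.cochainComplexXIso 0 0 rfl).inv_hom_id ((R.ι.f 0).hom m)
      refine (congrArg (fun t =>
        (R.cochainComplexXIso 1 1 rfl).inv.hom ((R.cocomplex.d 0 1).hom t)) this).trans ?_
      exact (congrArg (R.cochainComplexXIso 1 1 rfl).inv.hom (h3 m)).trans (map_zero _)

section

open scoped ModuleCat
variable {k G : Type u} [Field k] [Group G] [Fintype G]

/-- The quasi-isomorphism `res M ⟶ M ⟶ I` from the projective resolution which defines `res M` to
an injective resolution of `M`. Its cocone is a complete resolution of `M`. -/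
def resolutionMap (M : ModuleCat.{u} k[G]) : ((res k[G]).obj M).complex ⟶
    (injectiveResolution M).cochainComplex :=
  (projectiveResolution M).π' ≫ (injectiveResolution M).ι'

instance (M : ModuleCat.{u} k[G]) : QuasiIso (resolutionMap M) :=
  inferInstanceAs (QuasiIso ((projectiveResolution M).π' ≫ (injectiveResolution M).ι'))

instance (M : ModuleCat.{u} k[G]) : (((res k[G]).obj M).complex).IsStrictlyLE 0 :=
  inferInstanceAs ((projectiveResolution M).cochainComplex.IsStrictlyLE 0)

lemma projective_mappingCocone_resolutionMap (M : ModuleCat.{u} k[G]) (i : ℤ) :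
    Projective ((mappingCocone (resolutionMap M)).X i) :=
  have : Projective (((res k[G]).obj M).complex.X i) := ((res k[G]).obj M).property i
  have : Injective (((res k[G]).obj M).complex.X i) := injective_of_projective _
  projective_of_injective _

/-- For a trivial module `M` of dimension one, the cohomology of maps from the cocone of
`resolutionMap M` to `N` is the Tate cohomology of `N`. -/
lemma nonempty_homCohomology_iso_tateCohomology {M : ModuleCat.{u} k[G]} {m : M} (hm : m ≠ 0)
    (hg : ∀ g : G, MonoidAlgebra.single g (1 : k) • m = m) (hM : ∀ m' : M, ∃ c : k, m' = c • m)
    (N : ModuleCat.{u} k[G]) (i : ℤ) :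
    Nonempty (homCohomology k (mappingCocone (resolutionMap M)) N i ≅
      tateCohomology (Rep.ofModuleMonoidAlgebra.obj N) i) := by
  have hac := acyclic_mappingCocone (resolutionMap M)
  have hT := projective_mappingCocone_resolutionMap M
  obtain ⟨s, hs, hs'⟩ := exists_augmentation_injectiveResolution (injectiveResolution M)
  let u : M ⟶ (mappingCocone (resolutionMap M)).X 1 :=
    s ≫ (mappingCocone.inr (resolutionMap M)).1.v 0 1 (by simp)
  have hu : Function.Injective u.hom := by
    have : Mono s := (ModuleCat.mono_iff_injective s).2 hs
    have : Mono ((mappingCocone.inr (resolutionMap M)).1.v 0 1 (by simp)) :=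
      mono_of_mono_fac (mappingCocone.inr_v_snd_v (resolutionMap M) 0 1 (by simp))
    exact (ModuleCat.mono_iff_injective u).1 (mono_comp _ _)
  have hu' (z : (mappingCocone (resolutionMap M)).X 1) :
      ((mappingCocone (resolutionMap M)).d 1 2).hom z = 0 ↔ ∃ m, u.hom m = z := by
    rw [d_mappingCocone_eq_zero_iff_exists_inr]
    simp only [hs']
    exact ⟨fun ⟨_, ⟨m, hm⟩, h⟩ => ⟨m, by rw [← h, ← hm]; rfl⟩, fun ⟨m, h⟩ => ⟨_, ⟨m, rfl⟩, h⟩⟩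
  refine nonempty_homCohomology_iso_tateCohomology_of_zero hT hac
    (nonempty_homCohomology_zero_iso hT hac (u.hom m) ?_ ?_ ?_ ?_) i N
  · exact fun h => hm (hu (h.trans (map_zero _).symm))
  · intro g
    rw [← map_smul, hg]
  · exact (hu' _).2 ⟨m, rfl⟩
  · intro z hz
    obtain ⟨m', rfl⟩ := (hu' z).1 hz
    obtain ⟨c, rfl⟩ := hM m'
    exact ⟨c, LinearMap.map_smul_of_tower _ _ _⟩

omit [Fintype G] in
variable (k G) in
/-- The module of the trivial representation is spanned by a nonzero invariant vector. -/
lemma exists_generator_trivial : ∃ m : Rep.toModuleMonoidAlgebra.obj (Rep.trivial k G k), m ≠ 0 ∧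
    (∀ g : G, MonoidAlgebra.single g (1 : k) • m = m) ∧ ∀ m', ∃ c : k, m' = c • m := by
  let e : k ≃+ Rep.toModuleMonoidAlgebra.obj (Rep.trivial k G k) :=
    (Rep.trivial k G k).ρ.asModuleEquiv.symm.toAddEquiv
  refine ⟨e 1, e.map_ne_zero_iff.2 one_ne_zero, fun g => ?_, fun m => ⟨e.symm m, ?_⟩⟩
  · change MonoidAlgebra.single g (1 : k) • (Rep.trivial k G k).ρ.asModuleEquiv.symm 1 = _
    rw [Representation.single_smul, one_smul]
    rfl
  · rw [← algebraMap_smul k[G] (e.symm m) (e 1)]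
    refine (e.apply_symm_apply m).symm.trans ?_
    have := (Rep.trivial k G k).ρ.asModuleEquiv_symm_map_smul (e.symm m) (1 : k)
    rwa [smul_eq_mul, mul_one] at this

/-- The Tate Ext groups of the trivial representation, formed with any right adjoint of the
inclusion, are the Tate cohomology groups. -/
lemma nonempty_tateExt_trivial_iso (N : Rep.{u} k G) (eShriek : KProj k[G] ⥤ TateExt.E k[G])
    (adj : inclusion k[G] ⊣ eShriek) (i : ℤ) :
    Nonempty (tateExt k adj (Rep.toModuleMonoidAlgebra.obj (Rep.trivial k G k))
      (Rep.toModuleMonoidAlgebra.obj N) i ≅ tateCohomology N i) := by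
  let M : ModuleCat.{u} k[G] := Rep.toModuleMonoidAlgebra.obj (Rep.trivial k G k)
  obtain ⟨a⟩ := nonempty_homCohomology_iso adj
    (isAcyclicCoreflection_mappingCocone (resolutionMap M) (acyclic_mappingCocone _))
    (projective_mappingCocone_resolutionMap M) (Rep.toModuleMonoidAlgebra.obj N) i
  obtain ⟨m, hm, hg, hM⟩ := exists_generator_trivial k G
  obtain ⟨b⟩ := nonempty_homCohomology_iso_tateCohomology hm hg hM
    (Rep.toModuleMonoidAlgebra.obj N) i
  exact ⟨a ≪≫ b ≪≫ (tateCohomologyFunctor i).mapIso (Rep.unitIso N).symm⟩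

end

end

end TateExt

end

theorem mainTheorem6 (k G : Type u) [Field k] [Group G] [Fintype G]
    (N : Rep.{u} k G) [FiniteDimensional k N] :
    (TateExt.inclusion (MonoidAlgebra k G)).IsLeftAdjoint ∧
    ∀ (eShriek : TateExt.KProj (MonoidAlgebra k G) ⥤ TateExt.E (MonoidAlgebra k G))
      (adj : TateExt.inclusion (MonoidAlgebra k G) ⊣ eShriek) (i : ℤ),
      Nonempty
        (TateExt.tateExt k adj
            (Rep.toModuleMonoidAlgebra.obj (Rep.trivial k G k))
            (Rep.toModuleMonoidAlgebra.obj N) i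
          ≅ tateCohomology N i) := by
  exact ⟨TateExt.isLeftAdjoint_inclusion, TateExt.nonempty_tateExt_trivial_iso N⟩
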